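/- Let $k$ be a field and let $R=\bigoplus_{n\ge 0}R_n$ be a standard graded $k$-algebra, i.e. an $\mathbb N$-graded commutative $k$-algebra with $R_0=k$ that is generated over $k$ by finitely many elements of degree $1$. Let $\mathfrak m=\bigoplus_{n>0}R_n$ and $\beta_i(M)=\dim_k \mathrm{Tor}^R_i(R/\mathfrak m,M)$, with $\beta_{-1}(M)=0$. For a finitely generated $\mathbb{Z}$-graded $R$-module $M$ with minimal graded free resolution $F$, let $\mathcal F^iF\subseteq F$ be the subcomplex with $(\mathcal F^iF)_n=\mathfrak m^{i-n}F_n$ for $n\le i$ and $(\mathcal F^iF)_n=F_n$ for $n>i$. The linear part of $F$ is the complex $\mathrm{lin}^RF=\bigoplus_{i\ge 0}\mathcal F^iF/\mathcal F^{i+1}F$, and the linearity defect of $M$ is $\mathrm{ld}_R M=\sup\{n : H_n(\mathrm{lin}^R F)\ne 0\}\in\mathbb N\cup\{\infty\}$, with $\mathrm{ld}_R 0=0$. The module $M$ is Koszul if $\mathrm{ld}_R M=0$. The algebra $R$ is absolutely Koszul if $\mathrm{ld}_R M<\infty$ for every finitely generated $\mathbb{Z}$-graded $R$-module $M$. For nonzero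 homogeneous ideals $L_1,L_2$ and $L=L_1+L_2$, the decomposition $L=L_1+L_2$ is a Betti splitting if $\beta_i(L)=\beta_i(L_1)+\beta_i(L_2)+\beta_{i-1}(L_1\cap L_2)$ for all $i\ge 0$. Let $l_1,l_2\in R_1$ be nonzero linear forms with $l_1l_2=0$. Assume that there are nonzero homogeneous ideals $K_1,K_2$ of $R$, neither of which is generated by linear forms, such that 1. $(0):l_1=K_2+(l_2)$ and $(0):l_2=K_1+(l_1)$; 2. both of these decompositions are Betti splittings; 3. each of the modules $K_1\cap(l_1)$ and $K_2\cap(l_2)$ is either zero or Koszul. Then $\mathrm{ld}_R\,(l_1)=\mathrm{ld}_R\,(l_2)=\infty$. Hence $R$ is not absolutely Koszul. -/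

import Mathlib

universe u v

noncomputable section

/-- `R = ⨁ₙ 𝒜 n` is a standard graded `k`-algebra: `R₀ = k`, and `R` is generated over `k` by
finitely many elements of degree one. -/
structure IsStandardGraded {k : Type v} {R : Type u} [Field k] [CommRing R] [Algebra k R]
    (𝒜 : ℕ → Submodule k R) [GradedAlgebra 𝒜] : Prop where
  nontrivial : Nontrivial R
  /-- `R₀` is the image of `k` in `R`. -/
  degree_zero : 𝒜 0 = 1
  generated : ∃ S : Finset R, (S : Set R) ⊆ 𝒜 1 ∧ Algebra.adjoin k (S : Set R) = ⊤

section Grading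

variable {k : Type v} {R : Type u} [Field k] [CommRing R] [Algebra k R]
  (𝒜 : ℕ → Submodule k R)

/-- The component of degree `j ∈ ℤ` of `R`; it is zero for `j < 0`. -/
def intComponent (j : ℤ) : AddSubgroup R :=
  if 0 ≤ j then (𝒜 j.toNat).toAddSubgroup else ⊥

/-- `M = ⨁ⱼ ℳ j` is a `ℤ`-graded `R`-module. -/
structure IsGradedModule {M : Type u} [AddCommGroup M] [Module R M]
    (ℳ : ℤ → AddSubgroup M) : Prop where
  isInternal : DirectSum.IsInternal ℳ
  smul_mem : ∀ (n : ℕ) (j : ℤ) (a : R) (x : M), a ∈ 𝒜 n → x ∈ ℳ j → a • x ∈ ℳ (n + j)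

/-- The grading that an ideal inherits from `R`, namely `I j = I ∩ R j`. -/
def idealGrading (I : Ideal R) (j : ℤ) : AddSubgroup I :=
  (intComponent 𝒜 j).comap I.subtype.toAddMonoidHom

/-- `I` is generated by linear forms. -/
def GeneratedByLinearForms (I : Ideal R) : Prop :=
  ∃ S : Set R, S ⊆ 𝒜 1 ∧ I = Ideal.span S

variable [GradedAlgebra 𝒜]

/-- The graded maximal ideal `𝔪 = ⨁_{n > 0} R n`. -/
def gradedMaximalIdeal : Ideal R := (HomogeneousIdeal.irrelevant 𝒜).toIdeal

/-- A minimal graded free resolution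
`⋯ ⟶ F 2 ⟶ F 1 ⟶ F 0 ⟶ M ⟶ 0`
by free modules of finite rank, where `F n = ⨁_b R(-deg n b)`. The module underlying `F n` is
`R ^ rank n`, and its standard basis vector number `b` has degree `deg n b`. -/
structure MinimalGradedFreeResolution {M : Type u} [AddCommGroup M] [Module R M]
    (ℳ : ℤ → AddSubgroup M) where
  rank : ℕ → ℕ
  deg : (n : ℕ) → Fin (rank n) → ℤ
  /-- `d n : F (n + 1) ⟶ F n` -/
  d : (n : ℕ) → (Fin (rank (n + 1)) → R) →ₗ[R] (Fin (rank n) → R)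
  aug : (Fin (rank 0) → R) →ₗ[R] M
  /-- The differentials are homogeneous of degree zero. -/
  d_homogeneous : ∀ (n : ℕ) (b : Fin (rank (n + 1))) (a : Fin (rank n)),
    d n (Pi.single b 1) a ∈ intComponent 𝒜 (deg (n + 1) b - deg n a)
  /-- The augmentation is homogeneous of degree zero. -/
  aug_homogeneous : ∀ a : Fin (rank 0), aug (Pi.single a 1) ∈ ℳ (deg 0 a)
  exact_d : ∀ n : ℕ, Function.Exact (d (n + 1)) (d n)
  exact_aug : Function.Exact (d 0) aug
  aug_surjective : Function.Surjective aug
  /-- Minimality: `∂ (F (n + 1)) ⊆ 𝔪 F n`. -/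
  minimal : ∀ n : ℕ, LinearMap.range (d n) ≤
    gradedMaximalIdeal 𝒜 • (⊤ : Submodule R (Fin (rank n) → R))

namespace MinimalGradedFreeResolution

variable {𝒜} {M : Type u} [AddCommGroup M] [Module R M] {ℳ : ℤ → AddSubgroup M}
  (F : MinimalGradedFreeResolution 𝒜 ℳ)

/-- The term in homological degree `n` of the subcomplex
`𝓕^i F : ⋯ ⟶ F (i + 1) ⟶ F i ⟶ 𝔪 F (i - 1) ⟶ ⋯ ⟶ 𝔪 ^ (i - 1) F 1 ⟶ 𝔪 ^ i F 0 ⟶ 0`,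
that is `𝔪 ^ (i - n) F n` for `n ≤ i` and `F n` for `n ≥ i` (the subtraction is truncated). -/
def filt (i n : ℕ) : Submodule R (Fin (F.rank n) → R) :=
  gradedMaximalIdeal 𝒜 ^ (i - n) • ⊤

theorem map_d_filt (i n : ℕ) : (F.filt i (n + 1)).map (F.d n) ≤ F.filt i n := by
  unfold filt
  rw [Submodule.map_smul'', Submodule.map_top]
  rcases Nat.lt_or_ge n i with h | h
  · obtain ⟨j, rfl⟩ := Nat.exists_eq_add_of_lt h
    have h1 : n + j + 1 - (n + 1) = j := by omega
    have h2 : n + j + 1 - n = j + 1 := by omega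
    rw [h1, h2, pow_succ, Submodule.mul_smul]
    exact Submodule.smul_mono le_rfl (F.minimal n)
  · have h2 : i - n = 0 := by omega
    rw [h2, pow_zero, Ideal.one_eq_top, Submodule.top_smul]
    exact le_top

/-- The component `𝓕^i F n / 𝓕^(i+1) F n` of the linear part of `F`, in homological degree `n` and
internal degree `i`. -/
abbrev lin (i n : ℕ) : Type u :=
  (F.filt i n) ⧸ (F.filt (i + 1) n).submoduleOf (F.filt i n)

/-- The differential of the subcomplex `𝓕^i F`. -/
def filtD (i n : ℕ) : F.filt i (n + 1) →ₗ[R] F.filt i n :=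
  (F.d n).restrict fun _ hx => F.map_d_filt i n (Submodule.mem_map_of_mem hx)

theorem filtD_le (i n : ℕ) : (F.filt (i + 1) (n + 1)).submoduleOf (F.filt i (n + 1)) ≤
    ((F.filt (i + 1) n).submoduleOf (F.filt i n)).comap (F.filtD i n) := by
  intro x hx
  rw [Submodule.mem_comap, Submodule.submoduleOf, Submodule.mem_comap] at *
  exact F.map_d_filt (i + 1) n (Submodule.mem_map_of_mem hx)

/-- The differential of the linear part, induced by that of `F`. -/
def linD (i n : ℕ) : F.lin i (n + 1) →ₗ[R] F.lin i n :=
  Submodule.mapQ _ _ (F.filtD i n) (F.filtD_le i n)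

/-- Cycles of the linear part. -/
def linCycles (i : ℕ) : (n : ℕ) → Submodule R (F.lin i n)
  | 0 => ⊤
  | n + 1 => LinearMap.ker (F.linD i n)

/-- Boundaries of the linear part. -/
def linBoundaries (i n : ℕ) : Submodule R (F.lin i n) := LinearMap.range (F.linD i n)

/-- The component of internal degree `i` of the homology `H_n` of the linear part. -/
abbrev linHomology (i n : ℕ) : Type u :=
  F.linCycles i n ⧸ (F.linBoundaries i n).submoduleOf (F.linCycles i n)

end MinimalGradedFreeResolution

/-- The linearity defect `sup {n | H_n (lin F) ≠ 0}` of a graded module, where `F` is its minimal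
graded free resolution (all such resolutions are isomorphic, so the set does not depend on `F`).
The supremum is taken in `ℕ∞`; it is `0` for the zero module. -/
def linearityDefect {M : Type u} [AddCommGroup M] [Module R M] (ℳ : ℤ → AddSubgroup M) : ℕ∞ :=
  sSup {e : ℕ∞ | ∃ (F : MinimalGradedFreeResolution 𝒜 ℳ) (n : ℕ),
    e = n ∧ ∃ i : ℕ, Nontrivial (F.linHomology i n)}

/-- A module is Koszul if its linearity defect is zero. -/
def IsKoszulModule {M : Type u} [AddCommGroup M] [Module R M] (ℳ : ℤ → AddSubgroup M) : Prop :=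
  linearityDefect 𝒜 ℳ = 0

/-- `R` is absolutely Koszul: all finitely generated graded modules have finite linearity
defect. -/
def IsAbsolutelyKoszul : Prop :=
  ∀ (M : Type u) [AddCommGroup M] [Module R M] [Module.Finite R M] (ℳ : ℤ → AddSubgroup M),
    IsGradedModule 𝒜 ℳ → linearityDefect 𝒜 ℳ < ⊤

/-- The Betti number `β_i(M) = dim_k Tor_i^R(k, M)`, where `k` is the `R`-module `R / 𝔪`. -/
def bettiNumber (i : ℕ) (M : Type u) [AddCommGroup M] [Module R M] : ℕ :=
  Module.finrank k ((ModuleCat.restrictScalars (algebraMap k R)).obj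
    (((CategoryTheory.Tor (ModuleCat.{u} R) i).obj (ModuleCat.of R (R ⧸ gradedMaximalIdeal 𝒜))).obj
      (ModuleCat.of R M)))

/-- `L = L₁ + L₂` is a Betti splitting: `L₁, L₂ ≠ 0` and
`β_i(L) = β_i(L₁) + β_i(L₂) + β_{i-1}(L₁ ∩ L₂)` for all `i ≥ 0`, where `β_{-1} = 0`. -/
structure IsBettiSplitting {N : Type u} [AddCommGroup N] [Module R N]
    (L L₁ L₂ : Submodule R N) : Prop where
  left_ne_bot : L₁ ≠ ⊥
  right_ne_bot : L₂ ≠ ⊥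
  eq_sup : L = L₁ ⊔ L₂
  betti_zero : bettiNumber 𝒜 0 L = bettiNumber 𝒜 0 L₁ + bettiNumber 𝒜 0 L₂
  betti_succ : ∀ i : ℕ, bettiNumber 𝒜 (i + 1) L =
    bettiNumber 𝒜 (i + 1) L₁ + bettiNumber 𝒜 (i + 1) L₂ +
      bettiNumber 𝒜 i (L₁ ⊓ L₂ : Submodule R N)

end Grading

end

/-! For a linear form l, splicing a minimal resolution C of (0) : l onto R gives a minimal
resolution of (l), so homology of lin C in degree n + 1 reappears in degree n + 2 for (l)
(`LinHomologyNonzero.principal`). Two facts about C drive the proof.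

Start: K₂ is not generated by linear forms, so C has a basis vector sent into 𝔪². In the resolution
of (l₁) this vector is a cycle of the linear part in homological degree 1. By minimality it is not a
boundary (`linHomologyNonzero_principal_zero`). The same holds for l₂ with K₁.

Transfer: resolve K₂, (l₂) and their intersection minimally by A, B, P. The cone of P ⟶ A ⊕ B
resolves K₂ + (l₂) = (0) : l₁, and the Betti splitting says that its ranks are the Betti numbers, so
the cone is minimal (`isMinimal_cone`). Hence P ⟶ B has entries in 𝔪. As lin P is acyclic in
positive degrees, no positive-degree homology of lin B dies in the linear part of the cone
(`LinHomologyNonzero.cone`).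

Together, nonzero homology for (l₂) in some positive degree gives nonzero homology for (l₁) in the
next one, and symmetrically. Alternating between the two ideals reaches every positive degree. The
module (l₁) is then a witness against absolute Koszulness. -/

noncomputable section

open Filter

/-! ### Components and projections of R indexed by ℤ. -/

section IntegerGrading

variable {k : Type v} {R : Type u} [Field k] [CommRing R] [Algebra k R]
  (𝒜 : ℕ → Submodule k R)

theorem intComponent_of_nonneg {j : ℤ} (h : 0 ≤ j) :
    intComponent 𝒜 j = (𝒜 j.toNat).toAddSubgroup := if_pos h

theorem intComponent_of_neg {j : ℤ} (h : j < 0) : intComponent 𝒜 j = ⊥ := if_neg (not_le.2 h)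

theorem mem_intComponent_natCast {n : ℕ} {x : R} : x ∈ intComponent 𝒜 (n : ℤ) ↔ x ∈ 𝒜 n := by
  rw [intComponent_of_nonneg 𝒜 (Int.natCast_nonneg n), Int.toNat_natCast]
  rfl

/-- Membership in a component of `R`: either zero, or of a natural degree. -/
theorem mem_intComponent_iff {j : ℤ} {x : R} :
    x ∈ intComponent 𝒜 j ↔ x = 0 ∨ ∃ n : ℕ, j = n ∧ x ∈ 𝒜 n := by
  constructor
  · intro hx
    rcases lt_or_ge j 0 with h | h
    · rw [intComponent_of_neg 𝒜 h] at hx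
      exact Or.inl (AddSubgroup.mem_bot.1 hx)
    · obtain ⟨n, rfl⟩ := Int.eq_ofNat_of_zero_le h
      exact Or.inr ⟨n, rfl, (mem_intComponent_natCast 𝒜).1 hx⟩
  · rintro (rfl | ⟨n, rfl, hx⟩)
    · exact zero_mem _
    · exact (mem_intComponent_natCast 𝒜).2 hx

variable [GradedAlgebra 𝒜]

theorem mul_mem_intComponent {i j : ℤ} {x y : R} (hx : x ∈ intComponent 𝒜 i)
    (hy : y ∈ intComponent 𝒜 j) : x * y ∈ intComponent 𝒜 (i + j) := by
  rw [mem_intComponent_iff] at *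
  rcases hx with rfl | ⟨n, rfl, hx⟩
  · simp
  rcases hy with rfl | ⟨m, rfl, hy⟩
  · simp
  exact Or.inr ⟨n + m, by push_cast; rfl, SetLike.mul_mem_graded hx hy⟩

theorem one_mem_intComponent : (1 : R) ∈ intComponent 𝒜 0 :=
  (mem_intComponent_natCast 𝒜 (n := 0)).2 SetLike.GradedOne.one_mem

/-- The projection onto the component of degree `j ∈ ℤ`. -/
def intProj (j : ℤ) : R →+ R := if 0 ≤ j then GradedRing.proj 𝒜 j.toNat else 0

theorem intProj_natCast (n : ℕ) (x : R) : intProj 𝒜 n x = GradedRing.proj 𝒜 n x := by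
  simp [intProj]

theorem intProj_of_neg {j : ℤ} (h : j < 0) (x : R) : intProj 𝒜 j x = 0 := by
  simp [intProj, not_le.2 h]

theorem intProj_mem (j : ℤ) (x : R) : intProj 𝒜 j x ∈ intComponent 𝒜 j := by
  rcases lt_or_ge j 0 with h | h
  · rw [intProj_of_neg 𝒜 h]; exact zero_mem _
  · obtain ⟨n, rfl⟩ := Int.eq_ofNat_of_zero_le h
    rw [intProj_natCast, mem_intComponent_natCast]
    exact SetLike.coe_mem _

theorem intProj_of_mem {j : ℤ} {x : R} (hx : x ∈ intComponent 𝒜 j) : intProj 𝒜 j x = x := by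
  rcases (mem_intComponent_iff 𝒜).1 hx with rfl | ⟨n, rfl, hx⟩
  · simp
  · rw [intProj_natCast]
    exact DirectSum.decompose_of_mem_same _ hx

theorem intProj_of_mem_ne {i j : ℤ} {x : R} (hx : x ∈ intComponent 𝒜 i) (h : i ≠ j) :
    intProj 𝒜 j x = 0 := by
  rcases (mem_intComponent_iff 𝒜).1 hx with rfl | ⟨n, rfl, hx⟩
  · simp
  rcases lt_or_ge j 0 with hj | hj
  · exact intProj_of_neg 𝒜 hj _
  · obtain ⟨m, rfl⟩ := Int.eq_ofNat_of_zero_le hj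
    rw [intProj_natCast]
    exact DirectSum.decompose_of_mem_ne _ hx (fun e : n = m => h (by rw [e]))

theorem intProj_mul {e : ℤ} {w : R} (hw : w ∈ intComponent 𝒜 e) (j : ℤ) (x : R) :
    intProj 𝒜 j (x * w) = intProj 𝒜 (j - e) x * w := by
  induction x using DirectSum.Decomposition.inductionOn 𝒜 with
  | zero => simp
  | @homogeneous n m =>
    have hm : (m : R) ∈ intComponent 𝒜 (n : ℤ) := (mem_intComponent_natCast 𝒜).2 m.2
    by_cases h : (n : ℤ) = j - e
    · rw [← h, intProj_of_mem 𝒜 hm]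
      have := mul_mem_intComponent 𝒜 hm hw
      rw [h, sub_add_cancel] at this
      exact intProj_of_mem 𝒜 this
    · rw [intProj_of_mem_ne 𝒜 hm h, zero_mul]
      exact intProj_of_mem_ne 𝒜 (mul_mem_intComponent 𝒜 hm hw) (fun e' => h (by omega))
  | add a b ha hb => rw [add_mul, map_add, map_add, ha, hb, add_mul]

/-- Quantifying over all large finite sets T, rather than over a chosen support, lets finitely many
coordinates with different shifts e share one T. -/
theorem eventually_sum_intProj (e : ℤ) (x : R) :
    ∀ᶠ T : Finset ℤ in atTop, ∑ j ∈ T, intProj 𝒜 (j - e) x = x := by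
  induction x using DirectSum.Decomposition.inductionOn 𝒜 with
  | zero => simp
  | @homogeneous n m =>
    filter_upwards [eventually_ge_atTop {(n : ℤ) + e}] with T hT
    have hm : (m : R) ∈ intComponent 𝒜 (n : ℤ) := (mem_intComponent_natCast 𝒜).2 m.2
    rw [Finset.sum_eq_single ((n : ℤ) + e)]
    · rw [add_sub_cancel_right, intProj_of_mem 𝒜 hm]
    · intro j _ hj
      exact intProj_of_mem_ne 𝒜 hm (fun h => hj (by omega))
    · intro h
      exact absurd (hT (Finset.mem_singleton_self _)) h
  | add a b ha hb =>
    filter_upwards [ha, hb] with T h1 h2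
    simp only [map_add, Finset.sum_add_distrib, h1, h2]

theorem mem_gradedMaximalIdeal_iff {x : R} : x ∈ gradedMaximalIdeal 𝒜 ↔ intProj 𝒜 0 x = 0 := by
  have := intProj_natCast 𝒜 0 x
  rw [Nat.cast_zero] at this
  rw [this]
  exact HomogeneousIdeal.mem_irrelevant_iff 𝒜 x

theorem mem_gradedMaximalIdeal_of_mem {n : ℕ} (hn : n ≠ 0) {x : R} (hx : x ∈ 𝒜 n) :
    x ∈ gradedMaximalIdeal 𝒜 :=
  (mem_gradedMaximalIdeal_iff 𝒜).2
    (intProj_of_mem_ne 𝒜 ((mem_intComponent_natCast 𝒜).2 hx) (by exact_mod_cast hn))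

end IntegerGrading

/-! ### Consequences of standard gradedness. -/

namespace IsStandardGraded

variable {k : Type v} {R : Type u} [Field k] [CommRing R] [Algebra k R]
  {𝒜 : ℕ → Submodule k R} [GradedAlgebra 𝒜]

theorem isNoetherianRing (hR : IsStandardGraded 𝒜) : IsNoetherianRing R := by
  obtain ⟨S, -, hS⟩ := hR.generated
  have : Algebra.FiniteType k R := ⟨⟨S, hS⟩⟩
  exact Algebra.FiniteType.isNoetherianRing k R

theorem exists_algebraMap_eq (hR : IsStandardGraded 𝒜) {x : R} (hx : x ∈ 𝒜 0) :
    ∃ c : k, algebraMap k R c = x := by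
  rw [hR.degree_zero] at hx
  exact Submodule.mem_one.1 hx

theorem isUnit_of_mem_zero (hR : IsStandardGraded 𝒜) {x : R} (hx : x ∈ 𝒜 0)
    (h0 : x ≠ 0) : IsUnit x := by
  obtain ⟨c, rfl⟩ := hR.exists_algebraMap_eq hx
  refine (IsUnit.mk0 c ?_).map (algebraMap k R)
  rintro rfl
  simp at h0

theorem isUnit_intProj_zero (hR : IsStandardGraded 𝒜) {x : R} (hx : x ∉ gradedMaximalIdeal 𝒜) :
    IsUnit (intProj 𝒜 0 x) :=
  hR.isUnit_of_mem_zero ((mem_intComponent_natCast 𝒜 (n := 0)).1 (intProj_mem 𝒜 0 x))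
    (fun h => hx ((mem_gradedMaximalIdeal_iff 𝒜).2 h))

theorem gradedMaximalIdeal_ne_top (hR : IsStandardGraded 𝒜) : gradedMaximalIdeal 𝒜 ≠ ⊤ := by
  have := hR.nontrivial
  rw [Ideal.ne_top_iff_one, mem_gradedMaximalIdeal_iff, intProj_of_mem 𝒜 (one_mem_intComponent 𝒜)]
  exact one_ne_zero

theorem le_gradedMaximalIdeal (hR : IsStandardGraded 𝒜) {I : Ideal R} (hI : I.IsHomogeneous 𝒜)
    (h : I ≠ ⊤) :
    I ≤ gradedMaximalIdeal 𝒜 := by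
  intro x hx
  by_contra hx'
  refine h (Ideal.eq_top_of_isUnit_mem I ?_ (hR.isUnit_intProj_zero hx'))
  have := intProj_natCast 𝒜 0 x
  rw [Nat.cast_zero] at this
  rw [this]
  exact hI 0 hx

/-- Generation in degree 1 is essential here: a monomial of degree d in the generators is a product
of d elements of 𝔪. This is what lets the 𝔪-adic filtration detect degrees. -/
theorem component_le_pow (hR : IsStandardGraded 𝒜) (n : ℕ) {x : R} (hx : x ∈ 𝒜 n) :
    x ∈ gradedMaximalIdeal 𝒜 ^ n := by
  obtain ⟨S, hS1, hS⟩ := hR.generated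
  have key : ∀ y ∈ Submonoid.closure (S : Set R),
      ∃ d, y ∈ 𝒜 d ∧ y ∈ gradedMaximalIdeal 𝒜 ^ d := by
    intro y hy
    induction hy using Submonoid.closure_induction with
    | mem y hy => exact ⟨1, hS1 hy, by
        rw [pow_one]; exact mem_gradedMaximalIdeal_of_mem 𝒜 one_ne_zero (hS1 hy)⟩
    | one => exact ⟨0, SetLike.GradedOne.one_mem, by simp⟩
    | mul y z _ _ h1 h2 =>
      obtain ⟨d, h1, h1'⟩ := h1
      obtain ⟨e, h2, h2'⟩ := h2
      exact ⟨d + e, SetLike.mul_mem_graded h1 h2, by rw [pow_add]; exact Ideal.mul_mem_mul h1' h2'⟩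
  -- Stated for the projection of an arbitrary y because it is then a k-linear condition, which can
  -- be checked on the monomials spanning R.
  have hspan : ∀ y : R, GradedRing.proj 𝒜 n y ∈ gradedMaximalIdeal 𝒜 ^ n := by
    intro y
    have hy : y ∈ Submodule.span k (Submonoid.closure (S : Set R) : Set R) := by
      rw [← Algebra.adjoin_eq_span, hS]; trivial
    induction hy using Submodule.span_induction with
    | mem y hy =>
      obtain ⟨d, h1, h2⟩ := key y hy
      by_cases h : d = n
      · subst h
        rw [GradedRing.proj_apply, DirectSum.decompose_of_mem_same _ h1]
        exact h2
      · rw [GradedRing.proj_apply, DirectSum.decompose_of_mem_ne _ h1 h]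
        exact zero_mem _
    | zero => simp
    | add y z _ _ h1 h2 => rw [map_add]; exact add_mem h1 h2
    | smul c y _ h =>
      have : GradedRing.proj 𝒜 n (c • y) = algebraMap k R c * GradedRing.proj 𝒜 n y := by
        rw [← Algebra.smul_def]
        exact (GradedAlgebra.proj 𝒜 n).map_smul c y
      rw [this]
      exact Ideal.mul_mem_left _ _ h
  have := hspan x
  rwa [GradedRing.proj_apply, DirectSum.decompose_of_mem_same _ hx] at this

end IsStandardGraded

/-! ### Graded free modules and vectors with coordinates in an ideal. -/

section FreeModule

variable {k : Type v} {R : Type u} [Field k] [CommRing R] [Algebra k R]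
  (𝒜 : ℕ → Submodule k R) [GradedAlgebra 𝒜]

/-- The component of degree `j` of an element of the graded free module `⨁ R(-deg a)`. -/
def freeProj {ι : Type*} (deg : ι → ℤ) (j : ℤ) : (ι → R) →+ (ι → R) where
  toFun x a := intProj 𝒜 (j - deg a) (x a)
  map_zero' := by ext; simp
  map_add' x y := by ext; simp

@[simp] theorem freeProj_apply {ι : Type*} (deg : ι → ℤ) (j : ℤ) (x : ι → R) (a : ι) :
    freeProj 𝒜 deg j x a = intProj 𝒜 (j - deg a) (x a) := rfl

/-- A map of graded free modules that is homogeneous of degree zero. -/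
def IsHomogeneousMap {ι κ : Type*} [DecidableEq ι] (deg : ι → ℤ) (deg' : κ → ℤ)
    (f : (ι → R) →ₗ[R] (κ → R)) : Prop :=
  ∀ b a, f (Pi.single b 1) a ∈ intComponent 𝒜 (deg b - deg' a)

variable {𝒜}

theorem IsHomogeneousMap.map_freeProj {ι κ : Type*} [Fintype ι] [DecidableEq ι]
    {deg : ι → ℤ} {deg' : κ → ℤ} {f : (ι → R) →ₗ[R] (κ → R)} (hf : IsHomogeneousMap 𝒜 deg deg' f)
    (j : ℤ) (x : ι → R) : f (freeProj 𝒜 deg j x) = freeProj 𝒜 deg' j (f x) := by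
  rw [LinearMap.pi_apply_eq_sum_univ f x, LinearMap.pi_apply_eq_sum_univ f, map_sum]
  refine Finset.sum_congr rfl fun b _ => ?_
  ext a
  have h : (fun i => if b = i then (1 : R) else 0) = Pi.single b 1 := by
    ext i; simp [Pi.single_apply, eq_comm]
  rw [h]
  simp only [freeProj_apply, Pi.smul_apply, smul_eq_mul]
  rw [intProj_mul 𝒜 (hf b a)]
  rw [show j - deg' a - (deg b - deg' a) = j - deg b by ring]

theorem eventually_sum_freeProj {ι : Type*} [Finite ι] (deg : ι → ℤ) (x : ι → R) :
    ∀ᶠ T : Finset ℤ in atTop, ∑ j ∈ T, freeProj 𝒜 deg j x = x := by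
  have h : ∀ a, ∀ᶠ T : Finset ℤ in atTop, ∑ j ∈ T, intProj 𝒜 (j - deg a) (x a) = x a :=
    fun a => eventually_sum_intProj 𝒜 (deg a) (x a)
  filter_upwards [eventually_all.2 h] with T hT
  ext a
  rw [Finset.sum_apply]
  exact hT a

/-- The vectors all of whose coordinates lie in the ideal `I`. -/
abbrev coordIn (I : Ideal R) (ι : Type*) : Submodule R (ι → R) := Submodule.pi Set.univ fun _ => I

theorem mem_coordIn {I : Ideal R} {ι : Type*} {x : ι → R} : x ∈ coordIn I ι ↔ ∀ a, x a ∈ I := by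
  simp [coordIn]

theorem coordIn_eq_smul (I : Ideal R) (ι : Type*) [Finite ι] :
    coordIn I ι = I • (⊤ : Submodule R (ι → R)) := by
  classical
  have := Fintype.ofFinite ι
  apply le_antisymm
  · intro x hx
    rw [mem_coordIn] at hx
    rw [← Finset.univ_sum_single x]
    refine Submodule.sum_mem _ fun a _ => ?_
    have : (Pi.single a (x a) : ι → R) = x a • Pi.single a 1 := by
      rw [← Pi.single_smul, smul_eq_mul, mul_one]
    rw [this]
    exact Submodule.smul_mem_smul (hx a) trivial
  · rw [Submodule.smul_le]
    intro r hr x _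
    rw [mem_coordIn]
    intro a
    exact Ideal.mul_mem_right _ _ hr

theorem map_mem_coordIn {ι κ : Type*} [Finite ι] [Finite κ] (f : (ι → R) →ₗ[R] (κ → R))
    {I J : Ideal R} (hf : ∀ x, f x ∈ coordIn I κ) {x : ι → R} (hx : x ∈ coordIn J ι) :
    f x ∈ coordIn (J * I) κ := by
  rw [coordIn_eq_smul] at hx ⊢
  rw [Submodule.mul_smul, ← coordIn_eq_smul I]
  have h : f x ∈ (J • (⊤ : Submodule R (ι → R))).map f := Submodule.mem_map_of_mem hx
  rw [Submodule.map_smul''] at h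
  refine Submodule.smul_mono le_rfl ?_ h
  rintro _ ⟨y, -, rfl⟩
  exact hf y

end FreeModule

/-! ### Existence of minimal graded free resolutions of ideals. -/

section Resolutions

variable {k : Type v} {R : Type u} [Field k] [CommRing R] [Algebra k R]
  (𝒜 : ℕ → Submodule k R) [GradedAlgebra 𝒜]

/-- A homogeneous generating set of least cardinality works. A relation with a coefficient outside 𝔪
would have, in a suitable degree, a unit coefficient, and the corresponding generator could be
dropped. -/
theorem exists_minimal_cover (hR : IsStandardGraded 𝒜) {r : ℕ} (deg : Fin r → ℤ)
    (K : Submodule R (Fin r → R)) (hK : ∀ x ∈ K, ∀ j, freeProj 𝒜 deg j x ∈ K) :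
    ∃ (n : ℕ) (deg' : Fin n → ℤ) (f : (Fin n → R) →ₗ[R] (Fin r → R)),
      IsHomogeneousMap 𝒜 deg' deg f ∧ LinearMap.range f = K ∧
        ∀ x, f x = 0 → x ∈ coordIn (gradedMaximalIdeal 𝒜) (Fin n) := by
  classical
  have := hR.isNoetherianRing
  set H : Set (Fin r → R) := {w | w ∈ K ∧ ∃ e : ℤ, ∀ a, w a ∈ intComponent 𝒜 (e - deg a)} with hH
  have hHK : Submodule.span R H = K := by
    apply le_antisymm
    · exact Submodule.span_le.2 fun w hw => hw.1
    · intro x hx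
      obtain ⟨T, hT⟩ := (eventually_sum_freeProj (𝒜 := 𝒜) deg x).exists
      rw [← hT]
      exact Submodule.sum_mem _ fun j _ =>
        Submodule.subset_span ⟨hK x hx j, j, fun a => intProj_mem 𝒜 _ _⟩
  obtain ⟨S₀, hS₀, hS₀'⟩ := Submodule.fg_span_iff_fg_span_finset_subset H |>.1
    (IsNoetherian.noetherian (Submodule.span R H))
  obtain ⟨S, ⟨hSH, hSK⟩, hmin⟩ := (measure (Finset.card (α := Fin r → R))).wf.has_min
    {S | (S : Set (Fin r → R)) ⊆ H ∧ Submodule.span R (S : Set (Fin r → R)) = K}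
    ⟨S₀, hS₀, hS₀'.symm.trans hHK⟩
  let v : Fin S.card → (Fin r → R) := fun i => (S.equivFin.symm i : Fin r → R)
  have hvS : ∀ i, v i ∈ S := fun i => (S.equivFin.symm i).2
  have hv : Function.Injective v := fun i j h => S.equivFin.symm.injective (Subtype.ext h)
  have hrange : Set.range v = S := by
    ext w
    constructor
    · rintro ⟨i, rfl⟩; exact hvS i
    · intro hw
      exact ⟨S.equivFin ⟨w, hw⟩, by simp [v]⟩
  choose deg' hdeg' using fun i => (hSH (hvS i)).2
  have hf : IsHomogeneousMap 𝒜 deg' deg (Fintype.linearCombination R v) := by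
    intro b a
    rw [Fintype.linearCombination_apply_single, one_smul]
    exact hdeg' b a
  refine ⟨S.card, deg', Fintype.linearCombination R v, hf, ?_, ?_⟩
  · rw [Fintype.range_linearCombination, hrange, hSK]
  · intro x hx
    rw [mem_coordIn]
    intro a
    by_contra hxa
    obtain ⟨c, hc⟩ := hR.isUnit_intProj_zero hxa
    -- The component of degree `deg' a` is chosen because its coefficient at `a` is the degree-zero
    -- part of `x a`, a unit since R₀ = k.
    have h0 : Fintype.linearCombination R v (freeProj 𝒜 deg' (deg' a) x) = 0 := by
      rw [hf.map_freeProj, hx, map_zero]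
    rw [Fintype.linearCombination_apply, ← Finset.add_sum_erase _ _ (Finset.mem_univ a)] at h0
    simp only [freeProj_apply, sub_self] at h0
    rw [← hc] at h0
    have hva : v a ∈ Submodule.span R ((S.erase (v a) : Finset _) : Set (Fin r → R)) := by
      have h1 : (c : R) • v a ∈ Submodule.span R ((S.erase (v a) : Finset _) : Set (Fin r → R)) := by
        rw [eq_neg_of_add_eq_zero_left h0]
        refine Submodule.neg_mem _ (Submodule.sum_mem _ fun b hb => Submodule.smul_mem _ _ ?_)
        refine Submodule.subset_span (Finset.mem_coe.2 (Finset.mem_erase.2 ⟨fun h => ?_, hvS b⟩))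
        exact (Finset.mem_erase.1 hb).1 (hv h)
      have h2 := Submodule.smul_mem _ (↑c⁻¹ : R) h1
      rwa [smul_smul, Units.inv_mul, one_smul] at h2
    refine hmin (S.erase (v a)) ⟨fun w hw => hSH (Finset.mem_of_mem_erase hw), ?_⟩
      (Finset.card_erase_lt_of_mem (hvS a))
    apply le_antisymm
    · rw [← hSK]
      exact Submodule.span_mono fun w hw => Finset.mem_of_mem_erase hw
    · rw [← hSK, Submodule.span_le]
      intro w hw
      by_cases h : w = v a
      · rw [h]; exact hva
      · exact Submodule.subset_span (Finset.mem_coe.2 (Finset.mem_erase.2 ⟨h, hw⟩))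

/-- A graded free resolution of an ideal by free modules of finite rank. -/
structure IdealResolution (I : Ideal R) where
  ι : ℕ → Type
  [fintype : ∀ n, Fintype (ι n)]
  [decidableEq : ∀ n, DecidableEq (ι n)]
  deg : (n : ℕ) → ι n → ℤ
  d : (n : ℕ) → (ι (n + 1) → R) →ₗ[R] (ι n → R)
  aug : (ι 0 → R) →ₗ[R] R
  d_homogeneous : ∀ n, IsHomogeneousMap 𝒜 (deg (n + 1)) (deg n) (d n)
  aug_homogeneous : ∀ a, aug (Pi.single a 1) ∈ intComponent 𝒜 (deg 0 a)
  exact_d : ∀ n, Function.Exact (d (n + 1)) (d n)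
  exact_aug : Function.Exact (d 0) aug
  range_aug : LinearMap.range aug = I

attribute [instance] IdealResolution.fintype IdealResolution.decidableEq

theorem IdealResolution.aug_mem {𝒜 : ℕ → Submodule k R} {I : Ideal R} (F : IdealResolution 𝒜 I)
    (x : F.ι 0 → R) : F.aug x ∈ I := F.range_aug.le (LinearMap.mem_range_self F.aug x)

theorem IdealResolution.exists_aug_eq {𝒜 : ℕ → Submodule k R} {I : Ideal R}
    (F : IdealResolution 𝒜 I) {y : R} (hy : y ∈ I) : ∃ x, F.aug x = y := F.range_aug.ge hy

/-- A minimal resolution: the differentials have entries in the graded maximal ideal. -/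
def IdealResolution.IsMinimal {𝒜 : ℕ → Submodule k R} [GradedAlgebra 𝒜] {I : Ideal R}
    (F : IdealResolution 𝒜 I) : Prop :=
  ∀ n x, F.d n x ∈ coordIn (gradedMaximalIdeal 𝒜) (F.ι n)

/-- A homogeneous submodule of a graded free module of finite rank. -/
structure FreeGradedSubmodule where
  rank : ℕ
  deg : Fin rank → ℤ
  carrier : Submodule R (Fin rank → R)
  freeProj_mem : ∀ x ∈ carrier, ∀ j, freeProj 𝒜 deg j x ∈ carrier

namespace FreeGradedSubmodule

variable {𝒜}

section Syzygies

variable (hR : IsStandardGraded 𝒜) (K : FreeGradedSubmodule 𝒜)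

/-- The rank of a minimal graded cover. -/
def coverRank : ℕ := (exists_minimal_cover 𝒜 hR K.deg K.carrier K.freeProj_mem).choose

/-- The degrees of the generators of a minimal graded cover. -/
def coverDeg : Fin (K.coverRank hR) → ℤ :=
  (exists_minimal_cover 𝒜 hR K.deg K.carrier K.freeProj_mem).choose_spec.choose

/-- A minimal graded cover of a homogeneous submodule. -/
def cover : (Fin (K.coverRank hR) → R) →ₗ[R] (Fin K.rank → R) :=
  (exists_minimal_cover 𝒜 hR K.deg K.carrier K.freeProj_mem).choose_spec.choose_spec.choose

theorem cover_spec : IsHomogeneousMap 𝒜 (K.coverDeg hR) K.deg (K.cover hR) ∧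
    LinearMap.range (K.cover hR) = K.carrier ∧
      ∀ x, K.cover hR x = 0 → x ∈ coordIn (gradedMaximalIdeal 𝒜) (Fin (K.coverRank hR)) :=
  (exists_minimal_cover 𝒜 hR K.deg K.carrier K.freeProj_mem).choose_spec.choose_spec.choose_spec

/-- The kernel of a minimal graded cover. -/
def syzygy : FreeGradedSubmodule 𝒜 where
  rank := K.coverRank hR
  deg := K.coverDeg hR
  carrier := LinearMap.ker (K.cover hR)
  freeProj_mem x hx j := by
    rw [LinearMap.mem_ker] at *
    rw [(K.cover_spec hR).1.map_freeProj, hx, map_zero]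

/-- The iterated syzygies of a homogeneous submodule. -/
def iterSyzygy : ℕ → FreeGradedSubmodule 𝒜
  | 0 => K
  | n + 1 => (iterSyzygy n).syzygy hR

end Syzygies

/-- A homogeneous ideal as a submodule of the free module of rank one. -/
def ofIdeal {I : Ideal R} (hI : I.IsHomogeneous 𝒜) : FreeGradedSubmodule 𝒜 where
  rank := 1
  deg := 0
  carrier := Submodule.comap (LinearMap.proj 0 : (Fin 1 → R) →ₗ[R] R) I
  freeProj_mem x hx j := by
    rw [Submodule.mem_comap] at *
    simp only [LinearMap.proj_apply, freeProj_apply, Pi.zero_apply, sub_zero] at *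
    rcases lt_or_ge j 0 with h | h
    · rw [intProj_of_neg 𝒜 h]; exact zero_mem _
    · obtain ⟨n, rfl⟩ := Int.eq_ofNat_of_zero_le h
      rw [intProj_natCast]
      exact hI n hx

/-- Each `f n` covers the n-th syzygy and has the next one as kernel. Since `g` is injective,
composing `f 0` with it yields an augmentation onto I with unchanged kernel. -/
theorem exists_iterSyzygy (hR : IsStandardGraded 𝒜) {I : Ideal R} (hI : I.IsHomogeneous 𝒜) :
    ∃ (K : ℕ → FreeGradedSubmodule 𝒜)
      (f : ∀ n, (Fin (K (n + 1)).rank → R) →ₗ[R] (Fin (K n).rank → R))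
      (g : (Fin (K 0).rank → R) →ₗ[R] R),
      (∀ n, IsHomogeneousMap 𝒜 (K (n + 1)).deg (K n).deg (f n)) ∧
      (∀ n, LinearMap.range (f n) = (K n).carrier) ∧
      (∀ n, LinearMap.ker (f n) = (K (n + 1)).carrier) ∧
      (∀ n x, f n x = 0 → x ∈ coordIn (gradedMaximalIdeal 𝒜) _) ∧
      Function.Injective g ∧ (K 0).carrier.map g = I ∧
      ∀ (e : ℤ) (x : Fin (K 0).rank → R),
        (∀ a, x a ∈ intComponent 𝒜 (e - (K 0).deg a)) → g x ∈ intComponent 𝒜 e := by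
  have hinj : Function.Injective (LinearMap.proj 0 : (Fin 1 → R) →ₗ[R] R) := by
    intro x y h
    funext i
    rw [Subsingleton.elim i 0]
    exact h
  refine ⟨(ofIdeal hI).iterSyzygy hR, fun n => ((ofIdeal hI).iterSyzygy hR n).cover hR,
    (LinearMap.proj 0 : (Fin 1 → R) →ₗ[R] R),
    fun n => (((ofIdeal hI).iterSyzygy hR n).cover_spec hR).1,
    fun n => (((ofIdeal hI).iterSyzygy hR n).cover_spec hR).2.1,
    fun n => rfl,
    fun n => (((ofIdeal hI).iterSyzygy hR n).cover_spec hR).2.2, hinj, ?_, ?_⟩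
  · exact Submodule.map_comap_eq_of_surjective (fun x => ⟨fun _ => x, rfl⟩) I
  · intro e x hx
    have := hx (0 : Fin 1)
    rwa [show (iterSyzygy hR (ofIdeal hI) 0).deg (0 : Fin 1) = 0 from rfl, sub_zero] at this

end FreeGradedSubmodule

variable {𝒜}

theorem IdealResolution.exists_isMinimal (hR : IsStandardGraded 𝒜) {I : Ideal R}
    (hI : I.IsHomogeneous 𝒜) : ∃ F : IdealResolution 𝒜 I, F.IsMinimal := by
  obtain ⟨K, f, g, hhom, hrange, hker, hmin, hg, hgI, hghom⟩ :=
    FreeGradedSubmodule.exists_iterSyzygy hR hI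
  -- The ambient module of `K 0` is R itself, not a term of the resolution, whence the shift by one
  -- in all indices.
  refine ⟨{ ι := fun n => Fin (K (n + 1)).rank
            deg := fun n => (K (n + 1)).deg
            d := fun n => f (n + 1)
            aug := g.comp (f 0)
            d_homogeneous := fun n => hhom (n + 1)
            aug_homogeneous := fun a => hghom _ _ (hhom 0 a)
            exact_d := fun n => LinearMap.exact_iff.2 ((hker _).trans (hrange _).symm)
            exact_aug := ?_
            range_aug := ?_ }, ?_⟩
  · rw [LinearMap.exact_iff, LinearMap.ker_comp, LinearMap.ker_eq_bot.2 hg, hrange, ← hker]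
    rfl
  · rw [LinearMap.range_comp, hrange, hgI]
  · intro n x
    refine hmin n _ ?_
    rw [← LinearMap.mem_ker, hker, ← hrange]
    exact LinearMap.mem_range_self _ _

end Resolutions

open CategoryTheory MonoidalCategory

/-! ### Betti numbers as ranks, and minimality detected by them. -/

section Tor

variable {k : Type v} {R : Type u} [Field k] [CommRing R] [Algebra k R]

variable (k) in
/-- The `k`-dimension of an `R`-module. -/
def dimOver (M : ModuleCat.{u} R) : ℕ :=
  Module.finrank k ((ModuleCat.restrictScalars (algebraMap k R)).obj M)

theorem dimOver_congr {M N : ModuleCat.{u} R} (e : M ≅ N) : dimOver k M = dimOver k N :=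
  LinearEquiv.finrank_eq (((ModuleCat.restrictScalars (algebraMap k R)).mapIso e).toLinearEquiv)

/-- Homology is a quotient of the cycles, which form a subspace of the n-th term. In finite
dimension, equality of the two ends leaves no room for nonzero boundaries. -/
theorem chainComplex_d_eq_zero_of_dimOver (K : ChainComplex (ModuleCat.{u} R) ℕ) (n : ℕ)
    [Module.Finite k ((ModuleCat.restrictScalars (algebraMap k R)).obj (K.X n))]
    (h : dimOver k (K.homology n) = dimOver k (K.X n)) : K.d (n + 1) n = 0 := by
  let G := ModuleCat.restrictScalars (algebraMap k R)
  have hi : Function.Injective (G.map (K.iCycles n)).hom :=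
    (ModuleCat.mono_iff_injective (K.iCycles n)).1 inferInstance
  have hp : Function.Surjective (G.map (K.homologyπ n)).hom :=
    (ModuleCat.epi_iff_surjective (K.homologyπ n)).1 inferInstance
  have : Module.Finite k (G.obj (K.cycles n)) := Module.Finite.of_injective _ hi
  have h1 := LinearMap.finrank_le_finrank_of_injective hi
  have h2 : Module.finrank k (G.obj (K.cycles n)) = Module.finrank k (G.obj (K.homology n)) := by
    refine le_antisymm ?_ (LinearMap.finrank_le_finrank_of_surjective hp)
    exact h1.trans h.ge
  have : Module.Finite k (G.obj (K.homology n)) := Module.Finite.of_surjective _ hp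
  have hinj : Function.Injective (G.map (K.homologyπ n)).hom :=
    (LinearMap.injective_iff_surjective_of_finrank_eq_finrank h2).2 hp
  have : Mono (K.homologyπ n) := (ModuleCat.mono_iff_injective (K.homologyπ n)).2 hinj
  have hc : K.toCycles (n + 1) n = 0 := by
    rw [← cancel_mono (K.homologyπ n), K.toCycles_comp_homologyπ, Limits.zero_comp]
  rw [← K.toCycles_i (n + 1) n, hc, Limits.zero_comp]

theorem dimOver_homology_of_d_eq_zero (K : ChainComplex (ModuleCat.{u} R) ℕ)
    (h : ∀ n, K.d (n + 1) n = 0) (n : ℕ) : dimOver k (K.homology n) = dimOver k (K.X n) := by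
  have h1 : K.d n ((ComplexShape.down ℕ).next n) = 0 := by
    rcases n with _ | n
    · exact K.shape _ _ (by simp)
    · rw [ChainComplex.next_nat_succ]; exact h n
  have h2 : K.d ((ComplexShape.down ℕ).prev n) n = 0 := by
    rw [ChainComplex.prev]; exact h n
  have := K.isIso_iCycles n _ rfl h1
  have := K.isIso_homologyπ _ n rfl h2
  exact dimOver_congr ((asIso (K.homologyπ n)).symm ≪≫ asIso (K.iCycles n))

variable {𝒜 : ℕ → Submodule k R} {I : Ideal R}

namespace IdealResolution

variable (F : IdealResolution 𝒜 I)

/-- The underlying complex of a resolution. -/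
def chainComplex : ChainComplex (ModuleCat.{u} R) ℕ :=
  ChainComplex.of (fun n => ModuleCat.of R (F.ι n → R)) (fun n => ModuleCat.ofHom (F.d n))
    (fun n => by
      rw [← ModuleCat.ofHom_comp, (F.exact_d n).linearMap_comp_eq_zero]
      rfl)

theorem chainComplex_d (n : ℕ) : F.chainComplex.d (n + 1) n = ModuleCat.ofHom (F.d n) :=
  ChainComplex.of_d (fun n => ModuleCat.of R (F.ι n → R)) (fun n => ModuleCat.ofHom (F.d n)) n

/-- The augmentation of a resolution of `I`, as a map to `I`. -/
def augToIdeal : (F.ι 0 → R) →ₗ[R] I :=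
  F.aug.codRestrict I F.aug_mem

theorem augToIdeal_surjective : Function.Surjective F.augToIdeal := by
  intro ⟨y, hy⟩
  obtain ⟨x, rfl⟩ := F.exists_aug_eq hy
  exact ⟨x, rfl⟩

theorem exact_augToIdeal : Function.Exact (F.d 0) F.augToIdeal := by
  intro x
  rw [← F.exact_aug x, Subtype.ext_iff]
  rfl

theorem d_comp_augToIdeal :
    F.chainComplex.d 1 0 ≫ (ModuleCat.ofHom F.augToIdeal : F.chainComplex.X 0 ⟶ _) = 0 := by
  rw [F.chainComplex_d 0]
  refine ModuleCat.hom_ext (LinearMap.ext fun x => ?_)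
  exact (F.exact_augToIdeal _).2 ⟨x, rfl⟩

/-- The augmentation as a morphism of complexes to `I`, placed in degree zero. -/
def augToSingle : F.chainComplex ⟶ (ChainComplex.single₀ _).obj (ModuleCat.of R I) :=
  (ChainComplex.toSingle₀Equiv _ _).symm ⟨ModuleCat.ofHom F.augToIdeal, F.d_comp_augToIdeal⟩

theorem augToSingle_f_zero : F.augToSingle.f 0 = ModuleCat.ofHom F.augToIdeal :=
  ChainComplex.toSingle₀Equiv_symm_apply_f_zero _ F.d_comp_augToIdeal

theorem chainComplex_d_hom (n : ℕ) (x : F.ι (n + 1) → R) :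
    (F.chainComplex.d (n + 1) n).hom x = F.d n x := by
  rw [chainComplex_d]
  rfl

instance quasiIso_augToSingle : QuasiIso F.augToSingle where
  quasiIsoAt n := by
    cases n with
    | zero =>
      rw [ChainComplex.quasiIsoAt₀_iff, ShortComplex.quasiIso_iff_of_zeros']
      · constructor
        · rw [ShortComplex.ShortExact.moduleCat_exact_iff_function_exact]
          intro x
          change (F.augToSingle.f 0).hom x = 0 ↔ x ∈ Set.range (F.chainComplex.d (0 + 1) 0).hom
          rw [augToSingle_f_zero]
          refine (F.exact_augToIdeal x).trans (exists_congr fun y => ?_)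
          rw [← F.chainComplex_d_hom]
          exact Iff.rfl
        · change Epi (F.augToSingle.f 0)
          rw [augToSingle_f_zero]
          exact (ModuleCat.epi_iff_surjective _).2 F.augToIdeal_surjective
      · exact F.chainComplex.shape _ _ (by simp)
      · rfl
      · rfl
    | succ n =>
      rw [quasiIsoAt_iff_exactAt']
      · rw [HomologicalComplex.exactAt_iff' _ (n + 1 + 1) (n + 1) n (by simp) (by simp)]
        rw [ShortComplex.ShortExact.moduleCat_exact_iff_function_exact]
        have h1 : ⇑(F.chainComplex.d (n + 1) n).hom = F.d n := funext (F.chainComplex_d_hom n)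
        have h2 : ⇑(F.chainComplex.d (n + 1 + 1) (n + 1)).hom = F.d (n + 1) :=
          funext (F.chainComplex_d_hom (n + 1))
        intro x
        exact ((Eq.congr_left (congrFun h1 x)).trans (F.exact_d n x)).trans
          (exists_congr fun y => (Eq.congr_left (congrFun h2 y)).symm)
      · apply ChainComplex.exactAt_succ_single_obj

/-- A resolution as a projective resolution in the category of modules. -/
def projectiveResolution : ProjectiveResolution (ModuleCat.of R I) where
  complex := F.chainComplex
  projective n := ModuleCat.projective_of_free (Pi.basisFun R (F.ι n))
  π := F.augToSingle

end IdealResolution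

variable [GradedAlgebra 𝒜]

theorem bijective_algebraMap_quotient (hR : IsStandardGraded 𝒜) :
    Function.Bijective fun c : k => Ideal.Quotient.mk (gradedMaximalIdeal 𝒜) (algebraMap k R c) := by
  have : Nontrivial (R ⧸ gradedMaximalIdeal 𝒜) :=
    Ideal.Quotient.nontrivial_iff.2 hR.gradedMaximalIdeal_ne_top
  constructor
  · exact ((Ideal.Quotient.mk (gradedMaximalIdeal 𝒜)).comp (algebraMap k R)).injective
  · intro y
    obtain ⟨x, rfl⟩ := Ideal.Quotient.mk_surjective y
    obtain ⟨c, hc⟩ := hR.exists_algebraMap_eq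
      ((mem_intComponent_natCast 𝒜 (n := 0)).1 (intProj_mem 𝒜 0 x))
    refine ⟨c, ?_⟩
    change Ideal.Quotient.mk _ (algebraMap k R c) = _
    rw [hc, Ideal.Quotient.eq, mem_gradedMaximalIdeal_iff, map_sub,
      intProj_of_mem 𝒜 (intProj_mem 𝒜 0 x), sub_self]

/-- `(R / 𝔪)^ι` has `k`-dimension `|ι|`. -/
def quotientPiEquiv (hR : IsStandardGraded 𝒜) (ι : Type) :
    (ι → k) ≃ₗ[k] ((ModuleCat.restrictScalars.{u} (algebraMap k R)).obj
      (ModuleCat.of R (ι → R ⧸ gradedMaximalIdeal 𝒜))) :=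
  let M := (ModuleCat.restrictScalars.{u} (algebraMap k R)).obj
    (ModuleCat.of R (ι → R ⧸ gradedMaximalIdeal 𝒜))
  let f : (ι → k) →ₗ[k] M :=
    { toFun := fun c =>
        show M from fun a => Ideal.Quotient.mk (gradedMaximalIdeal 𝒜) (algebraMap k R (c a))
      map_add' := fun c c' => funext fun a => by
        rw [Pi.add_apply, map_add, map_add]
        rfl
      map_smul' := fun t c => funext fun a => by
        rw [Pi.smul_apply, smul_eq_mul, map_mul, map_mul]
        rfl }
  LinearEquiv.ofBijective f <| by
    have h := bijective_algebraMap_quotient hR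
    constructor
    · intro c c' hc
      funext a
      exact h.1 (congrFun hc a)
    · intro y
      choose c hc using fun a => h.2 ((show ι → R ⧸ gradedMaximalIdeal 𝒜 from y) a)
      exact ⟨c, funext hc⟩

/-- `R / 𝔪 ⊗ R^ι` in the category of modules. -/
def tensorPiIso (𝒜 : ℕ → Submodule k R) [GradedAlgebra 𝒜] (ι : Type) [Fintype ι] [DecidableEq ι] :
    ModuleCat.of R (R ⧸ gradedMaximalIdeal 𝒜) ⊗ ModuleCat.of R (ι → R) ≅
      ModuleCat.of R (ι → R ⧸ gradedMaximalIdeal 𝒜) :=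
  (TensorProduct.piScalarRight R R (R ⧸ gradedMaximalIdeal 𝒜) ι).toModuleIso

theorem finite_restrictScalars_tensor (hR : IsStandardGraded 𝒜) (ι : Type) [Fintype ι]
    [DecidableEq ι] : Module.Finite k ((ModuleCat.restrictScalars.{u} (algebraMap k R)).obj
      (ModuleCat.of R (R ⧸ gradedMaximalIdeal 𝒜) ⊗ ModuleCat.of R (ι → R))) :=
  Module.Finite.equiv ((quotientPiEquiv hR ι).trans
    ((ModuleCat.restrictScalars (algebraMap k R)).mapIso (tensorPiIso 𝒜 ι)).toLinearEquiv.symm)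

theorem dimOver_tensor (hR : IsStandardGraded 𝒜) (ι : Type) [Fintype ι] [DecidableEq ι] :
    dimOver k (ModuleCat.of R (R ⧸ gradedMaximalIdeal 𝒜) ⊗ ModuleCat.of R (ι → R)) =
      Fintype.card ι := by
  rw [dimOver_congr (tensorPiIso 𝒜 ι), dimOver, ← (quotientPiEquiv hR ι).finrank_eq,
    Module.finrank_fintype_fun_eq_card]

theorem lTensor_quotient_eq_zero_iff {ι κ : Type} [Fintype κ] [DecidableEq κ]
    (f : (ι → R) →ₗ[R] (κ → R)) (J : Ideal R) :
    f.lTensor (R ⧸ J) = 0 ↔ ∀ x, f x ∈ coordIn J κ := by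
  constructor
  · intro h x
    rw [mem_coordIn]
    intro a
    have h1 : (f.lTensor (R ⧸ J)) (1 ⊗ₜ x) = 0 := by rw [h, LinearMap.zero_apply]
    rw [LinearMap.lTensor_tmul] at h1
    have h2 := congrArg (TensorProduct.piScalarRight R R (R ⧸ J) κ) h1
    rw [TensorProduct.piScalarRight_apply, TensorProduct.piScalarRightHom_tmul, map_zero] at h2
    have h3 := congrFun h2 a
    simp only [Pi.zero_apply, Algebra.smul_def, mul_one] at h3
    exact Ideal.Quotient.eq_zero_iff_mem.1 h3
  · intro h
    refine TensorProduct.ext' fun t x => ?_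
    apply (TensorProduct.piScalarRight R R (R ⧸ J) κ).injective
    rw [LinearMap.lTensor_tmul, LinearMap.zero_apply, map_zero,
      TensorProduct.piScalarRight_apply, TensorProduct.piScalarRightHom_tmul]
    funext a
    have h1 : algebraMap R (R ⧸ J) (f x a) = 0 :=
      Ideal.Quotient.eq_zero_iff_mem.2 (mem_coordIn.1 (h x) a)
    rw [Pi.zero_apply, Algebra.smul_def, h1, zero_mul]

namespace IdealResolution

variable (F : IdealResolution 𝒜 I)

/-- The complex `R / 𝔪 ⊗ F`. -/
def tensorComplex : ChainComplex (ModuleCat.{u} R) ℕ :=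
  (((tensoringLeft (ModuleCat.{u} R)).obj
    (ModuleCat.of R (R ⧸ gradedMaximalIdeal 𝒜))).mapHomologicalComplex _).obj F.chainComplex

theorem tensorComplex_d_eq_zero_iff (n : ℕ) : F.tensorComplex.d (n + 1) n = 0 ↔
    ∀ x, F.d n x ∈ coordIn (gradedMaximalIdeal 𝒜) (F.ι n) := by
  rw [← lTensor_quotient_eq_zero_iff]
  have h : F.tensorComplex.d (n + 1) n =
      ModuleCat.of R (R ⧸ gradedMaximalIdeal 𝒜) ◁ F.chainComplex.d (n + 1) n := rfl
  have h' : (ModuleCat.of R (R ⧸ gradedMaximalIdeal 𝒜) ◁ ModuleCat.ofHom (F.d n)).hom =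
      (F.d n).lTensor (R ⧸ gradedMaximalIdeal 𝒜) := ModuleCat.hom_whiskerLeft _ _
  rw [h, chainComplex_d]
  exact ⟨fun h0 => h'.symm.trans (congrArg ModuleCat.Hom.hom h0),
    fun h0 => ModuleCat.hom_ext (h'.trans h0)⟩

/-- `Tor` is derived in its second variable, so a resolution of I, not of R / 𝔪, computes it. -/
theorem bettiNumber_eq (n : ℕ) : bettiNumber 𝒜 n I = dimOver k (F.tensorComplex.homology n) :=
  dimOver_congr (F.projectiveResolution.isoLeftDerivedObj _ n)

theorem bettiNumber_eq_card (hR : IsStandardGraded 𝒜) (hF : F.IsMinimal) (n : ℕ) :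
    bettiNumber 𝒜 n I = Fintype.card (F.ι n) := by
  rw [F.bettiNumber_eq, dimOver_homology_of_d_eq_zero F.tensorComplex
    (fun n => (F.tensorComplex_d_eq_zero_iff n).2 (hF n)) n]
  exact dimOver_tensor hR (F.ι n)

/-- If the ranks are already the Betti numbers, R / 𝔪 ⊗ F has homology as large as its terms, so its
differentials vanish. -/
theorem isMinimal_of_bettiNumber_eq_card (hR : IsStandardGraded 𝒜)
    (h : ∀ n, bettiNumber 𝒜 n I = Fintype.card (F.ι n)) : F.IsMinimal := by
  intro n
  rw [← tensorComplex_d_eq_zero_iff]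
  have : Module.Finite k ((ModuleCat.restrictScalars (algebraMap k R)).obj
      (F.tensorComplex.X n)) := finite_restrictScalars_tensor hR (F.ι n)
  refine chainComplex_d_eq_zero_of_dimOver (k := k) F.tensorComplex n ?_
  rw [← F.bettiNumber_eq, h]
  exact (dimOver_tensor hR (F.ι n)).symm

end IdealResolution

end Tor

/-! ### Graded comparison maps between resolutions. -/

section Lift

variable {k : Type v} {R : Type u} [Field k] [CommRing R] [Algebra k R]
  {𝒜 : ℕ → Submodule k R} [GradedAlgebra 𝒜]

/-- Arbitrary preimages of the basis vectors may be cut down to their component of the right degree,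
since `d` commutes with taking components. -/
theorem exists_homogeneous_lift {ι κ τ : Type*} [Fintype ι] [DecidableEq ι] [Fintype κ]
    [DecidableEq κ] {degι : ι → ℤ} {degκ : κ → ℤ} {degτ : τ → ℤ}
    {h : (ι → R) →ₗ[R] (τ → R)} (hh : IsHomogeneousMap 𝒜 degι degτ h)
    {d : (κ → R) →ₗ[R] (τ → R)} (hd : IsHomogeneousMap 𝒜 degκ degτ d)
    (hr : LinearMap.range h ≤ LinearMap.range d) :
    ∃ g : (ι → R) →ₗ[R] (κ → R), IsHomogeneousMap 𝒜 degι degκ g ∧ ∀ x, d (g x) = h x := by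
  choose y hy using fun b => hr (LinearMap.mem_range_self h (Pi.single b 1))
  have hz : ∀ b, d (freeProj 𝒜 degκ (degι b) (y b)) = h (Pi.single b 1) := by
    intro b
    rw [hd.map_freeProj, hy]
    ext a
    exact intProj_of_mem 𝒜 (hh b a)
  let g := Fintype.linearCombination R fun b => freeProj 𝒜 degκ (degι b) (y b)
  have hg : ∀ b, g (Pi.single b 1) = freeProj 𝒜 degκ (degι b) (y b) := by
    intro b
    rw [Fintype.linearCombination_apply_single, one_smul]
  refine ⟨g, fun b a => ?_, fun x => ?_⟩
  · rw [hg]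
    exact intProj_mem 𝒜 _ _
  · have : d.comp g = h := by
      refine (Pi.basisFun R ι).ext fun b => ?_
      rw [Pi.basisFun_apply, LinearMap.comp_apply, hg, hz]
    exact LinearMap.congr_fun this x

theorem IdealResolution.exists_lift {I J : Ideal R} (hIJ : I ≤ J) (P : IdealResolution 𝒜 I)
    (G : IdealResolution 𝒜 J) :
    ∃ α : ∀ n, (P.ι n → R) →ₗ[R] (G.ι n → R),
      (∀ n, IsHomogeneousMap 𝒜 (P.deg n) (G.deg n) (α n)) ∧
      (∀ x, G.aug (α 0 x) = P.aug x) ∧ ∀ n x, G.d n (α (n + 1) x) = α n (P.d n x) := by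
  -- The second condition on a lift is exactly what makes the next lift possible, so it is carried
  -- through the recursion.
  let σ : ℕ → Type u := fun n => {g : (P.ι n → R) →ₗ[R] (G.ι n → R) //
    IsHomogeneousMap 𝒜 (P.deg n) (G.deg n) g ∧
      ∀ x ∈ LinearMap.range (P.d n), g x ∈ LinearMap.range (G.d n)}
  have hzero : ∃ s : σ 0, ∀ x, G.aug (s.1 x) = P.aug x := by
    obtain ⟨g, hg, hg'⟩ := exists_homogeneous_lift (𝒜 := 𝒜) (degι := P.deg 0) (degκ := G.deg 0)
      (degτ := fun _ : Unit => 0)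
      (h := LinearMap.pi fun _ : Unit => P.aug) (d := LinearMap.pi fun _ : Unit => G.aug)
      (fun b _ => by rw [sub_zero]; exact P.aug_homogeneous b)
      (fun b _ => by rw [sub_zero]; exact G.aug_homogeneous b) (by
        rintro _ ⟨x, rfl⟩
        obtain ⟨y, hy⟩ := G.exists_aug_eq (hIJ (P.aug_mem x))
        exact ⟨y, funext fun _ => hy⟩)
    have hg'' : ∀ x, G.aug (g x) = P.aug x := fun x => congrFun (hg' x) ()
    refine ⟨⟨g, hg, ?_⟩, hg''⟩
    rintro _ ⟨x, rfl⟩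
    refine (G.exact_aug _).1 ?_
    rw [hg'']
    exact (P.exact_aug _).2 ⟨x, rfl⟩
  have hsucc : ∀ n (s : σ n), ∃ t : σ (n + 1), ∀ x, G.d n (t.1 x) = s.1 (P.d n x) := by
    rintro n ⟨s, hs, hs'⟩
    obtain ⟨g, hg, hg'⟩ := exists_homogeneous_lift (𝒜 := 𝒜) (degι := P.deg (n + 1))
      (degκ := G.deg (n + 1)) (degτ := G.deg n) (h := s.comp (P.d n)) (d := G.d n)
      (fun b a => by
        have h1 : P.d n (Pi.single b 1) =
            freeProj 𝒜 (P.deg n) (P.deg (n + 1) b) (P.d n (Pi.single b 1)) := by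
          ext c
          exact (intProj_of_mem 𝒜 (P.d_homogeneous n b c)).symm
        rw [LinearMap.comp_apply, h1, hs.map_freeProj]
        exact intProj_mem 𝒜 _ _)
      (G.d_homogeneous n) (by
        rintro _ ⟨x, rfl⟩
        exact hs' _ (LinearMap.mem_range_self _ _))
    refine ⟨⟨g, hg, ?_⟩, hg'⟩
    rintro _ ⟨x, rfl⟩
    refine (G.exact_d n _).1 ?_
    rw [hg', LinearMap.comp_apply, (P.exact_d n _).2 ⟨x, rfl⟩, map_zero]
  obtain ⟨s₀, hs₀⟩ := hzero
  choose next hnext using hsucc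
  let s : ∀ n, σ n := fun n => Nat.rec s₀ next n
  exact ⟨fun n => (s n).1, fun n => (s n).2.1, hs₀, fun n => hnext n (s n)⟩

end Lift

/-! ### Linear algebra of the mapping cone. -/

section Block

theorem exists_eq_sumElim {R a b p : Type*} (x : (a ⊕ b) ⊕ p → R) :
    ∃ (g : a → R) (f : b → R) (q : p → R), x = Sum.elim (Sum.elim g f) q :=
  ⟨fun i => x (.inl (.inl i)), fun i => x (.inl (.inr i)), fun i => x (.inr i), by
    ext ((i | i) | i) <;> rfl⟩

theorem sumElim_inj {R a b p : Type*} {g g' : a → R} {f f' : b → R} {q q' : p → R} :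
    Sum.elim (Sum.elim g f) q = Sum.elim (Sum.elim g' f') q' ↔ g = g' ∧ f = f' ∧ q = q' := by
  constructor
  · intro h
    exact ⟨funext fun i => congrFun h (.inl (.inl i)), funext fun i => congrFun h (.inl (.inr i)),
      funext fun i => congrFun h (.inr i)⟩
  · rintro ⟨rfl, rfl, rfl⟩
    rfl

variable {R : Type u} [CommRing R]

/-- The map `(g, f, p) ↦ (d g + α p, d f - β p, -d p)`. -/
def blockMap {a b p a' b' p' : Type*} (dA : (a' → R) →ₗ[R] (a → R)) (dB : (b' → R) →ₗ[R] (b → R))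
    (dP : (p' → R) →ₗ[R] (p → R)) (α : (p' → R) →ₗ[R] (a → R)) (β : (p' → R) →ₗ[R] (b → R)) :
    ((a' ⊕ b') ⊕ p' → R) →ₗ[R] ((a ⊕ b) ⊕ p → R) where
  toFun x := Sum.elim (Sum.elim
    (dA (fun i => x (Sum.inl (Sum.inl i))) + α (fun i => x (Sum.inr i)))
    (dB (fun i => x (Sum.inl (Sum.inr i))) - β (fun i => x (Sum.inr i))))
    (-dP (fun i => x (Sum.inr i)))
  map_add' x y := by
    ext ((i | i) | i)
    · change (dA ((fun i => x (.inl (.inl i))) + fun i => y (.inl (.inl i))) +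
        α ((fun i => x (Sum.inr i)) + fun i => y (Sum.inr i))) i = _
      simp only [map_add, Pi.add_apply, Sum.elim_inl]
      ring
    · change (dB ((fun i => x (.inl (.inr i))) + fun i => y (.inl (.inr i))) -
        β ((fun i => x (Sum.inr i)) + fun i => y (Sum.inr i))) i = _
      simp only [map_add, Pi.add_apply, Pi.sub_apply, Sum.elim_inl, Sum.elim_inr]
      ring
    · change (-dP ((fun i => x (Sum.inr i)) + fun i => y (Sum.inr i))) i = _
      simp only [map_add, Pi.add_apply, Pi.neg_apply, Sum.elim_inr]
      ring
  map_smul' r x := by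
    ext ((i | i) | i)
    · change (dA (r • fun i => x (.inl (.inl i))) + α (r • fun i => x (Sum.inr i))) i = _
      simp only [map_smul, Pi.add_apply, Pi.smul_apply, Sum.elim_inl, RingHom.id_apply, smul_add]
    · change (dB (r • fun i => x (.inl (.inr i))) - β (r • fun i => x (Sum.inr i))) i = _
      simp only [map_smul, Pi.sub_apply, Pi.smul_apply, Sum.elim_inl, Sum.elim_inr,
        RingHom.id_apply, smul_sub]
    · change (-dP (r • fun i => x (Sum.inr i))) i = _
      simp only [map_smul, Pi.neg_apply, Pi.smul_apply, Sum.elim_inr, RingHom.id_apply, smul_neg]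

theorem blockMap_elim {a b p a' b' p' : Type*} (dA : (a' → R) →ₗ[R] (a → R))
    (dB : (b' → R) →ₗ[R] (b → R)) (dP : (p' → R) →ₗ[R] (p → R)) (α : (p' → R) →ₗ[R] (a → R))
    (β : (p' → R) →ₗ[R] (b → R)) (x : a' → R) (y : b' → R) (z : p' → R) :
    blockMap dA dB dP α β (Sum.elim (Sum.elim x y) z) =
      Sum.elim (Sum.elim (dA x + α z) (dB y - β z)) (-dP z) := rfl

theorem sumElim_zero {a b p : Type*} :
    (0 : (a ⊕ b) ⊕ p → R) = Sum.elim (Sum.elim (0 : a → R) (0 : b → R)) (0 : p → R) := by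
  ext ((i | i) | i) <;> rfl

theorem sumElim_mem_coordIn {a b p : Type*} {J : Ideal R} {g : a → R} {f : b → R} {q : p → R} :
    Sum.elim (Sum.elim g f) q ∈ coordIn J ((a ⊕ b) ⊕ p) ↔
      g ∈ coordIn J a ∧ f ∈ coordIn J b ∧ q ∈ coordIn J p := by
  simp only [mem_coordIn, Sum.forall, Sum.elim_inl, Sum.elim_inr, and_assoc]

/-- The hypothesis `hP'` also mentions `g`: at the bottom of the cone the shifted differential is
zero, and `dP q = 0` alone does not make `q` a boundary. -/
theorem exact_blockMap {a b p a' b' p' a'' b'' p'' : Type*}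
    {dA : (a' → R) →ₗ[R] (a → R)} {dB : (b' → R) →ₗ[R] (b → R)} {dP : (p' → R) →ₗ[R] (p → R)}
    {α : (p' → R) →ₗ[R] (a → R)} {β : (p' → R) →ₗ[R] (b → R)}
    {dA' : (a'' → R) →ₗ[R] (a' → R)} {dB' : (b'' → R) →ₗ[R] (b' → R)}
    {dP' : (p'' → R) →ₗ[R] (p' → R)}
    {α' : (p'' → R) →ₗ[R] (a' → R)} {β' : (p'' → R) →ₗ[R] (b' → R)}
    (hA : Function.Exact dA' dA) (hB : Function.Exact dB' dB)
    (hα : ∀ x, dA (α' x) = α (dP' x)) (hβ : ∀ x, dB (β' x) = β (dP' x))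
    (hP : ∀ x, dP (dP' x) = 0)
    (hP' : ∀ q g, dP q = 0 → dA g + α q = 0 → ∃ x, dP' x = q) :
    Function.Exact (blockMap dA' dB' dP' α' β') (blockMap dA dB dP α β) := by
  intro x
  obtain ⟨g, f, q, rfl⟩ := exists_eq_sumElim x
  rw [blockMap_elim, sumElim_zero, sumElim_inj]
  constructor
  · rintro ⟨h1, h2, h3⟩
    obtain ⟨z, rfl⟩ := hP' q g (neg_eq_zero.1 h3) h1
    obtain ⟨s, hs⟩ := (hA (g + α' z)).1 (by rw [map_add, hα, h1])
    obtain ⟨t, ht⟩ := (hB (f - β' z)).1 (by rw [map_sub, hβ, h2])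
    refine ⟨Sum.elim (Sum.elim s t) (-z), ?_⟩
    rw [blockMap_elim, sumElim_inj]
    refine ⟨?_, ?_, ?_⟩
    · rw [hs, map_neg]; abel
    · rw [ht, map_neg]; abel
    · rw [map_neg, neg_neg]
  · rintro ⟨y, hy⟩
    obtain ⟨s, t, z, rfl⟩ := exists_eq_sumElim y
    rw [blockMap_elim, sumElim_inj] at hy
    obtain ⟨rfl, rfl, rfl⟩ := hy
    refine ⟨?_, ?_, ?_⟩
    · rw [map_add, (hA _).2 ⟨s, rfl⟩, hα, map_neg]; abel
    · rw [map_sub, (hB _).2 ⟨t, rfl⟩, hβ, map_neg]; abel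
    · rw [map_neg, hP, neg_zero, neg_zero]

/-- The map `(g, f, p) ↦ εA g + εB f`. -/
def coneAug {a b p : Type*} (εA : (a → R) →ₗ[R] R) (εB : (b → R) →ₗ[R] R) :
    ((a ⊕ b) ⊕ p → R) →ₗ[R] R :=
  εA.comp (LinearMap.funLeft R R fun i => Sum.inl (Sum.inl i)) +
    εB.comp (LinearMap.funLeft R R fun i => Sum.inl (Sum.inr i))

theorem coneAug_elim {a b p : Type*} (εA : (a → R) →ₗ[R] R) (εB : (b → R) →ₗ[R] R)
    (g : a → R) (f : b → R) (q : p → R) :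
    coneAug εA εB (Sum.elim (Sum.elim g f) q) = εA g + εB f := rfl

theorem exact_blockMap_coneAug {a b p a' b' p' : Type*} [IsEmpty p]
    {dA : (a' → R) →ₗ[R] (a → R)} {dB : (b' → R) →ₗ[R] (b → R)} {dP : (p' → R) →ₗ[R] (p → R)}
    {α : (p' → R) →ₗ[R] (a → R)} {β : (p' → R) →ₗ[R] (b → R)}
    {εA : (a → R) →ₗ[R] R} {εB : (b → R) →ₗ[R] R} {εP : (p' → R) →ₗ[R] R}
    (hA : Function.Exact dA εA) (hB : Function.Exact dB εB)
    (hα : ∀ x, εA (α x) = εP x) (hβ : ∀ x, εB (β x) = εP x)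
    (hP : ∀ g f, εA g + εB f = 0 → ∃ z, εP z = εA g) :
    Function.Exact (blockMap dA dB dP α β)
      (coneAug εA εB : ((a ⊕ b) ⊕ p → R) →ₗ[R] R) := by
  intro x
  obtain ⟨g, f, q, rfl⟩ := exists_eq_sumElim x
  rw [coneAug_elim]
  constructor
  · intro h
    obtain ⟨z, hz⟩ := hP g f h
    obtain ⟨s, hs⟩ := (hA (g - α z)).1 (by rw [map_sub, hα, hz, sub_self])
    obtain ⟨t, ht⟩ := (hB (f + β z)).1 (by rw [map_add, hβ, hz, add_comm, h])
    refine ⟨Sum.elim (Sum.elim s t) z, ?_⟩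
    rw [blockMap_elim, sumElim_inj]
    exact ⟨by rw [hs, sub_add_cancel], by rw [ht, add_sub_cancel_right], Subsingleton.elim _ _⟩
  · rintro ⟨y, hy⟩
    obtain ⟨s, t, z, rfl⟩ := exists_eq_sumElim y
    rw [blockMap_elim, sumElim_inj] at hy
    obtain ⟨rfl, rfl, -⟩ := hy
    rw [map_add, map_sub, (hA _).2 ⟨s, rfl⟩, (hB _).2 ⟨t, rfl⟩, hα, hβ]
    ring

theorem single_inl_inl {a b p : Type*} [DecidableEq a] [DecidableEq b] [DecidableEq p] (i : a) :
    (Pi.single (.inl (.inl i)) 1 : (a ⊕ b) ⊕ p → R) =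
      Sum.elim (Sum.elim (Pi.single i 1) (0 : b → R)) (0 : p → R) := by
  ext ((j | j) | j) <;> simp [Pi.single_apply]

theorem single_inl_inr {a b p : Type*} [DecidableEq a] [DecidableEq b] [DecidableEq p] (i : b) :
    (Pi.single (.inl (.inr i)) 1 : (a ⊕ b) ⊕ p → R) =
      Sum.elim (Sum.elim (0 : a → R) (Pi.single i 1)) (0 : p → R) := by
  ext ((j | j) | j) <;> simp [Pi.single_apply]

theorem single_inr {a b p : Type*} [DecidableEq a] [DecidableEq b] [DecidableEq p] (i : p) :
    (Pi.single (.inr i) 1 : (a ⊕ b) ⊕ p → R) =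
      Sum.elim (Sum.elim (0 : a → R) (0 : b → R)) (Pi.single i 1) := by
  ext ((j | j) | j) <;> simp [Pi.single_apply]

theorem coneAug_single_inl {a b p : Type*} [DecidableEq a] [DecidableEq b] [DecidableEq p]
    (εA : (a → R) →ₗ[R] R) (εB : (b → R) →ₗ[R] R) (i : a) :
    coneAug εA εB (Pi.single (.inl (.inl i)) 1 : (a ⊕ b) ⊕ p → R) = εA (Pi.single i 1) := by
  rw [single_inl_inl, coneAug_elim, map_zero, add_zero]

theorem coneAug_single_inr {a b p : Type*} [DecidableEq a] [DecidableEq b] [DecidableEq p]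
    (εA : (a → R) →ₗ[R] R) (εB : (b → R) →ₗ[R] R) (i : b) :
    coneAug εA εB (Pi.single (.inl (.inr i)) 1 : (a ⊕ b) ⊕ p → R) = εB (Pi.single i 1) := by
  rw [single_inl_inr, coneAug_elim, map_zero, zero_add]

variable {k : Type v} [Field k] [Algebra k R] {𝒜 : ℕ → Submodule k R}

theorem IsHomogeneousMap.blockMap {a b p a' b' p' : Type*} [DecidableEq a'] [DecidableEq b']
    [DecidableEq p'] {dega : a → ℤ} {degb : b → ℤ} {degp : p → ℤ} {dega' : a' → ℤ} {degb' : b' → ℤ}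
    {degp' : p' → ℤ}
    {dA : (a' → R) →ₗ[R] (a → R)} {dB : (b' → R) →ₗ[R] (b → R)} {dP : (p' → R) →ₗ[R] (p → R)}
    {α : (p' → R) →ₗ[R] (a → R)} {β : (p' → R) →ₗ[R] (b → R)}
    (hA : IsHomogeneousMap 𝒜 dega' dega dA) (hB : IsHomogeneousMap 𝒜 degb' degb dB)
    (hP : IsHomogeneousMap 𝒜 degp' degp dP) (hα : IsHomogeneousMap 𝒜 degp' dega α)
    (hβ : IsHomogeneousMap 𝒜 degp' degb β) :
    IsHomogeneousMap 𝒜 (Sum.elim (Sum.elim dega' degb') degp')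
      (Sum.elim (Sum.elim dega degb) degp) (blockMap dA dB dP α β) := by
  rintro ((i | i) | i) j
  · rw [single_inl_inl, blockMap_elim]
    rcases j with (j | j) | j
    · simpa using hA i j
    · simp
    · simp
  · rw [single_inl_inr, blockMap_elim]
    rcases j with (j | j) | j
    · simp
    · simpa using hB i j
    · simp
  · rw [single_inr, blockMap_elim]
    rcases j with (j | j) | j
    · simpa using hα i j
    · simpa using hβ i j
    · simpa using hP i j

end Block

/-! ### The cone resolving I + J, and the resolution of a principal ideal. -/

section Cone

variable {k : Type v} {R : Type u} [Field k] [CommRing R] [Algebra k R]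
  {𝒜 : ℕ → Submodule k R}

namespace IdealResolution

section Shift

variable {I : Ideal R} (P : IdealResolution 𝒜 I)

/-- The basis of the term in homological degree `n` of the shifted complex. -/
def shiftι : ℕ → Type
  | 0 => Empty
  | n + 1 => P.ι n

instance : IsEmpty (P.shiftι 0) := inferInstanceAs (IsEmpty Empty)

instance : ∀ n, Fintype (P.shiftι n)
  | 0 => inferInstanceAs (Fintype Empty)
  | n + 1 => inferInstanceAs (Fintype (P.ι n))

instance : ∀ n, DecidableEq (P.shiftι n)
  | 0 => inferInstanceAs (DecidableEq Empty)
  | n + 1 => inferInstanceAs (DecidableEq (P.ι n))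

/-- The degrees of the basis elements of the shifted complex. -/
def shiftDeg : ∀ n, P.shiftι n → ℤ
  | 0 => Empty.elim
  | n + 1 => P.deg n

/-- The differentials of the shifted complex. -/
def shiftD : ∀ n, (P.ι n → R) →ₗ[R] (P.shiftι n → R)
  | 0 => 0
  | n + 1 => P.d n

theorem shiftD_homogeneous : ∀ n, IsHomogeneousMap 𝒜 (P.deg n) (P.shiftDeg n) (P.shiftD n)
  | 0 => fun _ a => a.elim
  | n + 1 => P.d_homogeneous n

theorem shiftD_d {n : ℕ} (x : P.ι (n + 1) → R) : P.shiftD n (P.d n x) = 0 :=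
  match n with
  | 0 => rfl
  | n + 1 => (P.exact_d n _).2 ⟨x, rfl⟩

end Shift

variable {I J : Ideal R} (A : IdealResolution 𝒜 I) (B : IdealResolution 𝒜 J)
  (P : IdealResolution 𝒜 (I ⊓ J))
  (α : ∀ n, (P.ι n → R) →ₗ[R] (A.ι n → R)) (β : ∀ n, (P.ι n → R) →ₗ[R] (B.ι n → R))

/-- The mapping cone of `P ⟶ A ⊕ B`, a resolution of `I + J`. -/
def cone (hα : ∀ n, IsHomogeneousMap 𝒜 (P.deg n) (A.deg n) (α n))
    (hβ : ∀ n, IsHomogeneousMap 𝒜 (P.deg n) (B.deg n) (β n))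
    (hα₀ : ∀ x, A.aug (α 0 x) = P.aug x) (hβ₀ : ∀ x, B.aug (β 0 x) = P.aug x)
    (hαd : ∀ n x, A.d n (α (n + 1) x) = α n (P.d n x))
    (hβd : ∀ n x, B.d n (β (n + 1) x) = β n (P.d n x)) : IdealResolution 𝒜 (I ⊔ J) where
  ι n := (A.ι n ⊕ B.ι n) ⊕ P.shiftι n
  deg n := Sum.elim (Sum.elim (A.deg n) (B.deg n)) (P.shiftDeg n)
  d n := blockMap (A.d n) (B.d n) (P.shiftD n) (α n) (β n)
  aug := coneAug A.aug B.aug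
  d_homogeneous n := (A.d_homogeneous n).blockMap (B.d_homogeneous n) (P.shiftD_homogeneous n)
    (hα n) (hβ n)
  aug_homogeneous a := by
    rcases a with (a | a) | a
    · rw [coneAug_single_inl]
      exact A.aug_homogeneous a
    · rw [coneAug_single_inr]
      exact B.aug_homogeneous a
    · exact a.elim
  exact_d n := by
    refine exact_blockMap (A.exact_d n) (B.exact_d n) (hαd n) (hβd n)
      (fun x => P.shiftD_d x) fun q g hq hg => ?_
    match n with
    | 0 =>
      -- In degree zero the augmentation replaces the missing differential: that of `q` equals that
      -- of `α 0 q = -A.d 0 g`, which is zero.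
      have h : ∀ (q : P.ι 0 → R) (g : A.ι 1 → R), A.d 0 g + α 0 q = 0 → ∃ x, P.d 0 x = q := by
        intro q g hg
        refine (P.exact_aug q).1 ?_
        rw [← hα₀, eq_neg_of_add_eq_zero_right hg, map_neg, (A.exact_aug _).2 ⟨g, rfl⟩, neg_zero]
      exact h q g hg
    | n + 1 => exact (P.exact_d n q).1 hq
  exact_aug := exact_blockMap_coneAug A.exact_aug B.exact_aug hα₀ hβ₀ fun g f h =>
    P.exists_aug_eq ⟨A.aug_mem g, by
      rw [eq_neg_of_add_eq_zero_left h]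
      exact neg_mem (B.aug_mem f)⟩
  range_aug := by
    apply le_antisymm
    · rintro _ ⟨x, rfl⟩
      exact Submodule.add_mem_sup (A.aug_mem _) (B.aug_mem _)
    · intro y hy
      obtain ⟨a, ha, b, hb, rfl⟩ := Submodule.mem_sup.1 hy
      obtain ⟨g, rfl⟩ := A.exists_aug_eq ha
      obtain ⟨f, rfl⟩ := B.exists_aug_eq hb
      exact ⟨Sum.elim (Sum.elim g f) 0, rfl⟩

theorem cone_aug_single (hα : ∀ n, IsHomogeneousMap 𝒜 (P.deg n) (A.deg n) (α n))
    (hβ : ∀ n, IsHomogeneousMap 𝒜 (P.deg n) (B.deg n) (β n))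
    (hα₀ : ∀ x, A.aug (α 0 x) = P.aug x) (hβ₀ : ∀ x, B.aug (β 0 x) = P.aug x)
    (hαd : ∀ n x, A.d n (α (n + 1) x) = α n (P.d n x))
    (hβd : ∀ n x, B.d n (β (n + 1) x) = β n (P.d n x)) (a : A.ι 0) :
    (A.cone B P α β hα hβ hα₀ hβ₀ hαd hβd).aug (Pi.single (.inl (.inl a)) 1) =
      A.aug (Pi.single a 1) := coneAug_single_inl A.aug B.aug a

section Principal

variable {l : R} (C : IdealResolution 𝒜 ((⊥ : Ideal R).colon {l}))

/-- The index sets of the resolution of `(l)` obtained from a resolution of `(0) : l`. -/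
def principalι : ℕ → Type
  | 0 => Unit
  | n + 1 => C.ι n

instance : ∀ n, Fintype (C.principalι n)
  | 0 => inferInstanceAs (Fintype Unit)
  | n + 1 => inferInstanceAs (Fintype (C.ι n))

instance : ∀ n, DecidableEq (C.principalι n)
  | 0 => inferInstanceAs (DecidableEq Unit)
  | n + 1 => inferInstanceAs (DecidableEq (C.ι n))

/-- The degrees of the basis elements in the resolution of `(l)`. -/
def principalDeg : ∀ n, C.principalι n → ℤ
  | 0 => fun _ => 1
  | n + 1 => fun b => C.deg n b + 1

/-- The differentials in the resolution of `(l)`. -/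
def principalD : ∀ n, (C.ι n → R) →ₗ[R] (C.principalι n → R)
  | 0 => LinearMap.pi fun _ => C.aug
  | n + 1 => C.d n

theorem principalD_homogeneous : ∀ n,
    IsHomogeneousMap 𝒜 (fun b => C.deg n b + 1) (C.principalDeg n) (C.principalD n)
  | 0 => fun b _ => by
    change C.aug (Pi.single b 1) ∈ intComponent 𝒜 (C.deg 0 b + 1 - 1)
    rw [add_sub_cancel_right]
    exact C.aug_homogeneous b
  | n + 1 => fun b a => by
    change C.d n (Pi.single b 1) a ∈ intComponent 𝒜 (C.deg (n + 1) b + 1 - (C.deg n a + 1))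
    rw [add_sub_add_right_eq_sub]
    exact C.d_homogeneous n b a

theorem exact_principalD : ∀ n, Function.Exact (C.d n) (C.principalD n)
  | 0 => fun x => by
    rw [← C.exact_aug x]
    exact ⟨fun h => congrFun h (), fun h => funext fun _ => h⟩
  | n + 1 => C.exact_d n

/-- The resolution `⋯ ⟶ C 1 ⟶ C 0 ⟶ R ⟶ (l)` for a linear form `l` and a resolution `C` of
`(0) : l`. -/
def principal (hl : l ∈ 𝒜 1) : IdealResolution 𝒜 (Ideal.span {l}) where
  ι := C.principalι
  deg := C.principalDeg
  d := C.principalD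
  aug := (LinearMap.toSpanSingleton R R l).comp (LinearMap.proj (R := R) (φ := fun _ => R) ())
  d_homogeneous := C.principalD_homogeneous
  aug_homogeneous a := by
    change (Pi.single a 1 : Unit → R) () • l ∈ intComponent 𝒜 ((1 : ℕ) : ℤ)
    rw [mem_intComponent_natCast]
    have : (Pi.single a 1 : Unit → R) () = 1 := Pi.single_eq_same (M := fun _ => R) () 1
    rwa [this, one_smul]
  exact_d := C.exact_principalD
  exact_aug x := by
    change x () • l = 0 ↔ ∃ y, (LinearMap.pi fun _ : Unit => C.aug) y = x
    constructor
    · intro h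
      have h' : x () ∈ (⊥ : Ideal R).colon {l} := by
        rw [Submodule.mem_colon_singleton]
        exact h
      obtain ⟨y, hy⟩ := C.exists_aug_eq h'
      exact ⟨y, funext fun _ => hy⟩
    · rintro ⟨y, rfl⟩
      have := C.aug_mem y
      rw [Submodule.mem_colon_singleton] at this
      exact this
  range_aug := by
    apply le_antisymm
    · rintro _ ⟨x, rfl⟩
      exact Ideal.mul_mem_left _ _ (Ideal.mem_span_singleton_self l)
    · intro y hy
      obtain ⟨a, rfl⟩ := Ideal.mem_span_singleton'.1 hy
      exact ⟨fun _ => a, rfl⟩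

end Principal

end IdealResolution

end Cone

/-! ### Reading coordinates off block maps. -/

section BlockMembership

variable {R : Type u} [CommRing R] {a b p a' b' p' : Type*} {dA : (a' → R) →ₗ[R] (a → R)}
  {dB : (b' → R) →ₗ[R] (b → R)} {dP : (p' → R) →ₗ[R] (p → R)} {α : (p' → R) →ₗ[R] (a → R)}
  {β : (p' → R) →ₗ[R] (b → R)} {J : Ideal R}

theorem coordIn_mono {J' : Ideal R} (h : J ≤ J') {x : a → R} (hx : x ∈ coordIn J a) :
    x ∈ coordIn J' a :=
  mem_coordIn.2 fun i => h (mem_coordIn.1 hx i)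

theorem mem_coordIn_of_blockMap (h : ∀ x, blockMap dA dB dP α β x ∈ coordIn J ((a ⊕ b) ⊕ p))
    (x : p' → R) : β x ∈ coordIn J b := by
  have := h (Sum.elim (Sum.elim 0 0) x)
  rw [blockMap_elim, sumElim_mem_coordIn] at this
  simp only [map_zero, zero_sub] at this
  exact neg_mem_iff.1 this.2.1

theorem blockMap_elim_mem_coordIn {x : b' → R} (hx : dB x ∈ coordIn J b) :
    blockMap dA dB dP α β (Sum.elim (Sum.elim 0 x) 0) ∈ coordIn J ((a ⊕ b) ⊕ p) := by
  rw [blockMap_elim, sumElim_mem_coordIn]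
  simp only [map_zero, add_zero, sub_zero, neg_zero]
  exact ⟨zero_mem _, hx, zero_mem _⟩

theorem exists_of_sub_blockMap_mem {J' : Ideal R} {x : b → R} {y : (a' ⊕ b') ⊕ p' → R}
    (hy : y ∈ coordIn J' ((a' ⊕ b') ⊕ p'))
    (h : Sum.elim (Sum.elim (0 : a → R) x) (0 : p → R) - blockMap dA dB dP α β y ∈
      coordIn J ((a ⊕ b) ⊕ p)) :
    ∃ f ∈ coordIn J' b', ∃ q ∈ coordIn J' p', dP q ∈ coordIn J p ∧
      x - (dB f - β q) ∈ coordIn J b := by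
  obtain ⟨g, f, q, rfl⟩ := exists_eq_sumElim y
  rw [sumElim_mem_coordIn] at hy
  have h' : (Sum.elim (Sum.elim 0 x) 0 : (a ⊕ b) ⊕ p → R) -
      blockMap dA dB dP α β (Sum.elim (Sum.elim g f) q) =
      Sum.elim (Sum.elim (0 - (dA g + α q)) (x - (dB f - β q))) (0 - -dP q) := by
    rw [blockMap_elim]
    ext ((i | i) | i) <;> rfl
  rw [h', sumElim_mem_coordIn, zero_sub (-dP q), neg_neg] at h
  exact ⟨f, hy.2.1, q, hy.2.2, h.2.2, h.2.1⟩

end BlockMembership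

/-! ### Nonvanishing homology of the linear part. -/

section LinearPart

variable {k : Type v} {R : Type u} [Field k] [CommRing R] [Algebra k R]
  {𝒜 : ℕ → Submodule k R} [GradedAlgebra 𝒜]

namespace IdealResolution

variable {I J : Ideal R}

/-- The component of internal degree `i` of the homology of the linear part is nonzero in
homological degree `n + 1`. -/
def LinHomologyNonzero (F : IdealResolution 𝒜 I) (i n : ℕ) : Prop :=
  ∃ x ∈ coordIn (gradedMaximalIdeal 𝒜 ^ (i - (n + 1))) (F.ι (n + 1)),
    F.d n x ∈ coordIn (gradedMaximalIdeal 𝒜 ^ (i + 1 - n)) (F.ι n) ∧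
      ∀ y ∈ coordIn (gradedMaximalIdeal 𝒜 ^ (i - (n + 1 + 1))) (F.ι (n + 1 + 1)),
        x - F.d (n + 1) y ∉ coordIn (gradedMaximalIdeal 𝒜 ^ (i + 1 - (n + 1))) (F.ι (n + 1))

section Cone

variable (A : IdealResolution 𝒜 I) (B : IdealResolution 𝒜 J) (P : IdealResolution 𝒜 (I ⊓ J))
  (α : ∀ n, (P.ι n → R) →ₗ[R] (A.ι n → R)) (β : ∀ n, (P.ι n → R) →ₗ[R] (B.ι n → R))
  (hα : ∀ n, IsHomogeneousMap 𝒜 (P.deg n) (A.deg n) (α n))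
  (hβ : ∀ n, IsHomogeneousMap 𝒜 (P.deg n) (B.deg n) (β n))
  (hα₀ : ∀ x, A.aug (α 0 x) = P.aug x) (hβ₀ : ∀ x, B.aug (β 0 x) = P.aug x)
  (hαd : ∀ n x, A.d n (α (n + 1) x) = α n (P.d n x))
  (hβd : ∀ n x, B.d n (β (n + 1) x) = β n (P.d n x))

/-- The n-th rank of the cone is the sum of the n-th ranks of A and B and the (n - 1)-st rank of P,
which is the right-hand side of the splitting formula. -/
theorem isMinimal_cone (hR : IsStandardGraded 𝒜) (hA : A.IsMinimal) (hB : B.IsMinimal)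
    (hP : P.IsMinimal) (hs : IsBettiSplitting 𝒜 (I ⊔ J) I J) :
    (A.cone B P α β hα hβ hα₀ hβ₀ hαd hβd).IsMinimal := by
  refine isMinimal_of_bettiNumber_eq_card _ hR fun n => ?_
  have hcard : Fintype.card ((A.cone B P α β hα hβ hα₀ hβ₀ hαd hβd).ι n) =
      Fintype.card (A.ι n) + Fintype.card (B.ι n) + Fintype.card (P.shiftι n) := by
    rw [← Fintype.card_sum, ← Fintype.card_sum]
    rfl
  rw [hcard, ← A.bettiNumber_eq_card hR hA, ← B.bettiNumber_eq_card hR hB]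
  match n with
  | 0 => rw [hs.betti_zero, Fintype.card_eq_zero, add_zero]
  | n + 1 =>
    rw [hs.betti_succ, P.bettiNumber_eq_card hR hP]
    rfl

/-- If a class of lin B became a boundary in the cone, the P-component q of the bounding chain would
be a cycle of lin P, hence a boundary there modulo higher filtration. Correcting by that boundary,
and using that β gains a factor 𝔪, would bound the class already in lin B. -/
theorem LinHomologyNonzero.cone (hP : ∀ i n, ¬P.LinHomologyNonzero i n)
    (hC : (A.cone B P α β hα hβ hα₀ hβ₀ hαd hβd).IsMinimal) {i n : ℕ}
    (hB : B.LinHomologyNonzero i n) :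
    (A.cone B P α β hα hβ hα₀ hβ₀ hαd hβd).LinHomologyNonzero i n := by
  obtain ⟨x, hx, hdx, hx'⟩ := hB
  -- Otherwise the truncated exponent i + 1 - (n + 1) is 0 and every element counts as a boundary.
  -- The bound also makes i - 1 harmless below.
  have hin : n + 1 ≤ i := by
    by_contra hlt
    refine hx' 0 (zero_mem _) (mem_coordIn.2 fun a => ?_)
    rw [show i + 1 - (n + 1) = 0 by omega, pow_zero, Ideal.one_eq_top]
    trivial
  have hβm : ∀ n x, β n x ∈ coordIn (gradedMaximalIdeal 𝒜) (B.ι n) :=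
    fun n => mem_coordIn_of_blockMap (hC n)
  refine ⟨Sum.elim (Sum.elim (0 : A.ι (n + 1) → R) x) (0 : P.ι n → R),
    sumElim_mem_coordIn.2 ⟨zero_mem _, hx, zero_mem _⟩,
    blockMap_elim_mem_coordIn hdx, fun y hy hmem => ?_⟩
  obtain ⟨f, hf, q, hq, hdq, hxf⟩ : ∃ f ∈ coordIn (gradedMaximalIdeal 𝒜 ^ (i - (n + 1 + 1)))
      (B.ι (n + 1 + 1)), ∃ q ∈ coordIn (gradedMaximalIdeal 𝒜 ^ (i - (n + 1 + 1))) (P.ι (n + 1)),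
      P.d n q ∈ coordIn (gradedMaximalIdeal 𝒜 ^ (i + 1 - (n + 1))) (P.ι n) ∧
      x - (B.d (n + 1) f - β (n + 1) q) ∈
        coordIn (gradedMaximalIdeal 𝒜 ^ (i + 1 - (n + 1))) (B.ι (n + 1)) :=
    exists_of_sub_blockMap_mem hy hmem
  -- P sits one homological degree higher in the cone, so its filtration index drops by one.
  have hPq := hP (i - 1) n
  rw [LinHomologyNonzero] at hPq
  push Not at hPq
  obtain ⟨z, hz, hqz⟩ := hPq q (coordIn_mono (Ideal.pow_le_pow_right (by omega)) hq)
    (coordIn_mono (Ideal.pow_le_pow_right (by omega)) hdq)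
  have h1 : β (n + 1) (q - P.d (n + 1) z) ∈
      coordIn (gradedMaximalIdeal 𝒜 ^ (i + 1 - (n + 1))) (B.ι (n + 1)) := by
    refine coordIn_mono ?_ (map_mem_coordIn (β (n + 1)) (hβm _) hqz)
    rw [← pow_succ]
    exact Ideal.pow_le_pow_right (by omega)
  have h2 : β (n + 2) z ∈ coordIn (gradedMaximalIdeal 𝒜 ^ (i - (n + 1 + 1))) (B.ι (n + 2)) := by
    refine coordIn_mono ?_ (map_mem_coordIn (β (n + 2)) (hβm _) hz)
    rw [← pow_succ]
    exact Ideal.pow_le_pow_right (by omega)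
  -- The bounding chain in B: `β` commutes with the differentials, so only `β (n + 1)` of the
  -- remainder `q - P.d (n + 1) z` is left over.
  refine hx' (f - β (n + 2) z) (sub_mem hf h2) ?_
  have h3 : x - B.d (n + 1) (f - β (n + 2) z) =
      x - (B.d (n + 1) f - β (n + 1) q) - β (n + 1) (q - P.d (n + 1) z) := by
    rw [map_sub, map_sub, hβd]
    abel
  rw [h3]
  exact sub_mem hxf h1

end Cone

section Principal

variable {l : R}

theorem IsMinimal.principal {C : IdealResolution 𝒜 ((⊥ : Ideal R).colon {l})} (hC : C.IsMinimal)
    (hl : l ∈ 𝒜 1) (hle : (⊥ : Ideal R).colon {l} ≤ gradedMaximalIdeal 𝒜) :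
    (C.principal hl).IsMinimal
  | 0 => fun x => mem_coordIn.2 fun _ => hle (C.aug_mem x)
  | n + 1 => hC n

/-- Filtration index and homological degree both grow by one, so all exponents of 𝔪 are unchanged,
and the differentials involved are those of C. -/
theorem LinHomologyNonzero.principal {C : IdealResolution 𝒜 ((⊥ : Ideal R).colon {l})}
    (hl : l ∈ 𝒜 1) {i n : ℕ} (h : C.LinHomologyNonzero i n) :
    (C.principal hl).LinHomologyNonzero (i + 1) (n + 1) := by
  obtain ⟨x, hx, hdx, hx'⟩ := h
  rw [LinHomologyNonzero]
  simp only [Nat.add_sub_add_right] at hx' ⊢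
  exact ⟨x, hx, hdx, hx'⟩

/-- The basis vector `b` is sent into 𝔪², so it is a cycle of the linear part. Its coordinate 1 is
not in 𝔪, while boundaries have coordinates in 𝔪 by minimality. -/
theorem linHomologyNonzero_principal_zero {C : IdealResolution 𝒜 ((⊥ : Ideal R).colon {l})}
    (hm : gradedMaximalIdeal 𝒜 ≠ ⊤) (hC : C.IsMinimal) (hl : l ∈ 𝒜 1) {b : C.ι 0}
    (hb : C.aug (Pi.single b 1) ∈ gradedMaximalIdeal 𝒜 ^ 2) :
    (C.principal hl).LinHomologyNonzero 1 0 := by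
  have key : ∀ y : C.ι 1 → R, Pi.single b 1 - C.d 0 y ∉
      coordIn (gradedMaximalIdeal 𝒜 ^ 1) (C.ι 0) := by
    intro y hy
    rw [pow_one] at hy
    have h1 := mem_coordIn.1 (add_mem hy (hC 0 y)) b
    rw [sub_add_cancel, Pi.single_eq_same] at h1
    exact hm ((Ideal.eq_top_iff_one _).2 h1)
  refine ⟨(Pi.single b 1 : C.ι 0 → R), mem_coordIn.2 fun a => ?_, mem_coordIn.2 fun _ => hb,
    fun y _ => key y⟩
  rw [Nat.sub_self, pow_zero, Ideal.one_eq_top]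
  trivial

end Principal

/-- The generators of I given by the basis are homogeneous. Outside 𝔪² they are nonzero of degree at
most 1, and degree 0 would give a unit in I ≠ R. -/
theorem exists_aug_mem_sq (hR : IsStandardGraded 𝒜) (A : IdealResolution 𝒜 I)
    (hI : ¬GeneratedByLinearForms 𝒜 I) (hI' : I ≠ ⊤) :
    ∃ a, A.aug (Pi.single a 1) ∈ gradedMaximalIdeal 𝒜 ^ 2 := by
  by_contra hno
  push Not at hno
  refine hI ⟨Set.range fun a => A.aug (Pi.single a 1), ?_, ?_⟩
  · rintro _ ⟨a, rfl⟩
    rcases (mem_intComponent_iff 𝒜).1 (A.aug_homogeneous a) with h | ⟨n, -, h⟩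
    · exact absurd (by rw [h]; exact zero_mem _) (hno a)
    · rcases n with _ | _ | n
      · by_cases h0 : A.aug (Pi.single a 1) = 0
        · exact absurd (by rw [h0]; exact zero_mem _) (hno a)
        · exact absurd (Ideal.eq_top_of_isUnit_mem I (A.aug_mem _) (hR.isUnit_of_mem_zero h h0)) hI'
      · exact h
      · exact absurd (Ideal.pow_le_pow_right (by omega) (hR.component_le_pow _ h)) (hno a)
  · have h := (Pi.basisFun R (A.ι 0)).span_eq
    refine A.range_aug.symm.trans ?_
    rw [← Submodule.map_top, ← h, Submodule.map_span, ← Set.range_comp]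
    refine congrArg (Submodule.span R) (congrArg Set.range (funext fun a => ?_))
    rw [Function.comp_apply, Pi.basisFun_apply]

end IdealResolution

end LinearPart

/-! ### Passage to bases indexed by `Fin` and to the linearity defect. -/

section Conversion

variable {k : Type v} {R : Type u} [Field k] [CommRing R] [Algebra k R]
  {𝒜 : ℕ → Submodule k R}

namespace IdealResolution

variable {I : Ideal R} (F : IdealResolution 𝒜 I)

/-- Reindexing of a basis by an initial segment of `ℕ`. -/
def finEquiv (n : ℕ) : (Fin (Fintype.card (F.ι n)) → R) ≃ₗ[R] (F.ι n → R) :=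
  LinearEquiv.funCongrLeft R R (Fintype.equivFin (F.ι n))

theorem finEquiv_single (n : ℕ) (b : Fin (Fintype.card (F.ι n))) :
    F.finEquiv n (Pi.single b 1) = Pi.single ((Fintype.equivFin (F.ι n)).symm b) 1 := by
  ext a
  change (Pi.single b 1 : Fin _ → R) (Fintype.equivFin (F.ι n) a) = _
  simp only [Pi.single_apply, Equiv.eq_symm_apply]

theorem finEquiv_mem_coordIn {n : ℕ} {J : Ideal R} {x : Fin (Fintype.card (F.ι n)) → R} :
    F.finEquiv n x ∈ coordIn J (F.ι n) ↔ x ∈ coordIn J (Fin (Fintype.card (F.ι n))) := by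
  rw [mem_coordIn, mem_coordIn]
  exact (Fintype.equivFin (F.ι n)).forall_congr_left.trans (by
    refine forall_congr' fun a => ?_
    change x (Fintype.equivFin (F.ι n) ((Fintype.equivFin (F.ι n)).symm a)) ∈ J ↔ _
    rw [Equiv.apply_symm_apply])

theorem finEquiv_symm_mem_coordIn {n : ℕ} {J : Ideal R} {x : F.ι n → R} :
    (F.finEquiv n).symm x ∈ coordIn J (Fin (Fintype.card (F.ι n))) ↔ x ∈ coordIn J (F.ι n) := by
  rw [← F.finEquiv_mem_coordIn, LinearEquiv.apply_symm_apply]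

end IdealResolution

variable [GradedAlgebra 𝒜]

theorem MinimalGradedFreeResolution.nontrivial_linHomology_iff {M : Type u} [AddCommGroup M]
    [Module R M] {ℳ : ℤ → AddSubgroup M} (G : MinimalGradedFreeResolution 𝒜 ℳ) (i n : ℕ) :
    Nontrivial (G.linHomology i (n + 1)) ↔ ∃ x ∈ G.filt i (n + 1), G.d n x ∈ G.filt (i + 1) n ∧
      ∀ y ∈ G.filt i (n + 1 + 1), x - G.d (n + 1) y ∉ G.filt (i + 1) (n + 1) := by
  rw [Submodule.Quotient.nontrivial_iff, Ne, Submodule.submoduleOf_eq_top,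
    SetLike.not_le_iff_exists]
  have hker : ∀ x : G.filt i (n + 1), Submodule.Quotient.mk x ∈ G.linCycles i (n + 1) ↔
      G.d n x ∈ G.filt (i + 1) n := by
    intro x
    change Submodule.mapQ _ _ (G.filtD i n) (G.filtD_le i n) (Submodule.Quotient.mk x) = 0 ↔ _
    rw [Submodule.mapQ_apply, Submodule.Quotient.mk_eq_zero]
    rfl
  have hrange : ∀ x : G.filt i (n + 1), Submodule.Quotient.mk x ∈ G.linBoundaries i (n + 1) ↔
      ∃ y ∈ G.filt i (n + 1 + 1), (x : Fin (G.rank (n + 1)) → R) - G.d (n + 1) y ∈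
        G.filt (i + 1) (n + 1) := by
    intro x
    have hmk : ∀ y : G.filt i (n + 1 + 1),
        G.linD i (n + 1) (Submodule.Quotient.mk y) = Submodule.Quotient.mk x ↔
        (x : Fin (G.rank (n + 1)) → R) - G.d (n + 1) y ∈ G.filt (i + 1) (n + 1) := by
      intro y
      change Submodule.mapQ _ _ (G.filtD i (n + 1)) (G.filtD_le i (n + 1))
        (Submodule.Quotient.mk y) = _ ↔ _
      rw [Submodule.mapQ_apply, eq_comm, Submodule.Quotient.eq]
      rfl
    constructor
    · rintro ⟨y, hy⟩
      obtain ⟨y, rfl⟩ := Submodule.Quotient.mk_surjective _ y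
      exact ⟨y, y.2, (hmk y).1 hy⟩
    · rintro ⟨y, hy, h⟩
      exact ⟨_, (hmk ⟨y, hy⟩).2 h⟩
  constructor
  · rintro ⟨z, hz, hz'⟩
    obtain ⟨x, rfl⟩ := Submodule.Quotient.mk_surjective _ z
    rw [hker] at hz
    rw [hrange] at hz'
    push Not at hz'
    exact ⟨x, x.2, hz, hz'⟩
  · rintro ⟨x, hx, hdx, h⟩
    refine ⟨Submodule.Quotient.mk ⟨x, hx⟩, (hker ⟨x, hx⟩).2 hdx, fun hmem => ?_⟩
    obtain ⟨y, hy, hxy⟩ := (hrange ⟨x, hx⟩).1 hmem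
    exact h y hy hxy

theorem MinimalGradedFreeResolution.filt_eq_coordIn {M : Type u} [AddCommGroup M]
    [Module R M] {ℳ : ℤ → AddSubgroup M} (G : MinimalGradedFreeResolution 𝒜 ℳ) (i n : ℕ) :
    G.filt i n = coordIn (gradedMaximalIdeal 𝒜 ^ (i - n)) (Fin (G.rank n)) :=
  (coordIn_eq_smul _ _).symm

namespace IdealResolution

variable {I : Ideal R} (F : IdealResolution 𝒜 I)

/-- A minimal resolution of a homogeneous ideal, with bases indexed by `Fin`. -/
def toMinimalGradedFreeResolution (hF : F.IsMinimal) :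
    MinimalGradedFreeResolution 𝒜 (idealGrading 𝒜 I) where
  rank n := Fintype.card (F.ι n)
  deg n b := F.deg n ((Fintype.equivFin (F.ι n)).symm b)
  d n := (F.finEquiv n).symm.toLinearMap ∘ₗ F.d n ∘ₗ (F.finEquiv (n + 1)).toLinearMap
  aug := F.augToIdeal ∘ₗ (F.finEquiv 0).toLinearMap
  d_homogeneous n b a := by
    change (F.finEquiv n).symm (F.d n (F.finEquiv (n + 1) (Pi.single b 1))) a ∈ _
    rw [finEquiv_single]
    exact F.d_homogeneous n _ _
  aug_homogeneous a := by
    change F.augToIdeal (F.finEquiv 0 (Pi.single a 1)) ∈ _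
    rw [finEquiv_single]
    exact F.aug_homogeneous _
  exact_d n x := by
    change (F.finEquiv n).symm (F.d n (F.finEquiv (n + 1) x)) = 0 ↔ ∃ y,
      (F.finEquiv (n + 1)).symm (F.d (n + 1) (F.finEquiv (n + 2) y)) = x
    rw [LinearEquiv.map_eq_zero_iff, F.exact_d n, Set.mem_range,
      (F.finEquiv (n + 2)).surjective.exists]
    simp only [LinearEquiv.symm_apply_eq]
  exact_aug x := by
    change F.augToIdeal (F.finEquiv 0 x) = 0 ↔ ∃ y,
      (F.finEquiv 0).symm (F.d 0 (F.finEquiv 1 y)) = x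
    rw [F.exact_augToIdeal, Set.mem_range, (F.finEquiv 1).surjective.exists]
    simp only [LinearEquiv.symm_apply_eq]
  aug_surjective := F.augToIdeal_surjective.comp (F.finEquiv 0).surjective
  minimal n := by
    rintro _ ⟨x, rfl⟩
    rw [← coordIn_eq_smul]
    exact F.finEquiv_symm_mem_coordIn.2 (hF n _)

theorem nontrivial_linHomology_iff (hF : F.IsMinimal) (i n : ℕ) :
    Nontrivial ((F.toMinimalGradedFreeResolution hF).linHomology i (n + 1)) ↔
      F.LinHomologyNonzero i n := by
  rw [MinimalGradedFreeResolution.nontrivial_linHomology_iff]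
  simp only [MinimalGradedFreeResolution.filt_eq_coordIn]
  change (∃ x ∈ coordIn (gradedMaximalIdeal 𝒜 ^ (i - (n + 1))) (Fin (Fintype.card (F.ι (n + 1)))),
    (F.finEquiv n).symm (F.d n (F.finEquiv (n + 1) x)) ∈
      coordIn (gradedMaximalIdeal 𝒜 ^ (i + 1 - n)) (Fin (Fintype.card (F.ι n))) ∧
    ∀ y ∈ coordIn (gradedMaximalIdeal 𝒜 ^ (i - (n + 1 + 1)))
        (Fin (Fintype.card (F.ι (n + 1 + 1)))),
      x - (F.finEquiv (n + 1)).symm (F.d (n + 1) (F.finEquiv (n + 2) y)) ∉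
        coordIn (gradedMaximalIdeal 𝒜 ^ (i + 1 - (n + 1)))
          (Fin (Fintype.card (F.ι (n + 1))))) ↔ _
  rw [LinHomologyNonzero, (F.finEquiv (n + 1)).surjective.exists]
  refine exists_congr fun x => ?_
  rw [(F.finEquiv (n + 1 + 1)).surjective.forall]
  refine and_congr F.finEquiv_mem_coordIn.symm (and_congr F.finEquiv_symm_mem_coordIn
    (forall_congr' fun y => imp_congr F.finEquiv_mem_coordIn.symm (not_congr ?_)))
  rw [← F.finEquiv_mem_coordIn, map_sub, LinearEquiv.apply_symm_apply]

/-- The supremum ranges over all minimal resolutions, so any single one bounds it from below and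
uniqueness up to isomorphism is never needed. -/
theorem LinHomologyNonzero.le_linearityDefect {F : IdealResolution 𝒜 I} (hF : F.IsMinimal)
    {i n : ℕ} (h : F.LinHomologyNonzero i n) :
    ((n + 1 : ℕ) : ℕ∞) ≤ linearityDefect 𝒜 (idealGrading 𝒜 I) :=
  le_sSup ⟨F.toMinimalGradedFreeResolution hF, n + 1, rfl, i,
    (F.nontrivial_linHomology_iff hF i n).2 h⟩

theorem not_linHomologyNonzero_of_isKoszulModule (hF : F.IsMinimal)
    (h : IsKoszulModule 𝒜 (idealGrading 𝒜 I)) (i n : ℕ) : ¬F.LinHomologyNonzero i n := by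
  intro hn
  have := hn.le_linearityDefect hF
  rw [show linearityDefect 𝒜 (idealGrading 𝒜 I) = 0 from h, nonpos_iff_eq_zero] at this
  exact absurd this (by exact_mod_cast Nat.succ_ne_zero n)

/-- The resolution of the zero ideal by zero modules. -/
def zero (𝒜 : ℕ → Submodule k R) : IdealResolution 𝒜 (⊥ : Ideal R) where
  ι _ := Empty
  deg _ := Empty.elim
  d _ := 0
  aug := 0
  d_homogeneous _ b := b.elim
  aug_homogeneous a := a.elim
  exact_d _ _ := ⟨fun _ => ⟨0, Subsingleton.elim _ _⟩, fun _ => Subsingleton.elim _ _⟩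
  exact_aug _ := ⟨fun _ => ⟨0, Subsingleton.elim _ _⟩, fun _ => rfl⟩
  range_aug := LinearMap.range_zero

theorem exists_linear_acyclic (hR : IsStandardGraded 𝒜) (hI : I.IsHomogeneous 𝒜)
    (h : I = ⊥ ∨ IsKoszulModule 𝒜 (idealGrading 𝒜 I)) :
    ∃ F : IdealResolution 𝒜 I, F.IsMinimal ∧ ∀ i n, ¬F.LinHomologyNonzero i n := by
  rcases h with rfl | h
  · refine ⟨zero 𝒜, fun n x => mem_coordIn.2 fun a => a.elim, ?_⟩
    rintro i n ⟨x, -, -, hx⟩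
    exact hx 0 (zero_mem _) (mem_coordIn.2 fun a => a.elim)
  · obtain ⟨F, hF⟩ := exists_isMinimal hR hI
    exact ⟨F, hF, F.not_linHomologyNonzero_of_isKoszulModule hF h⟩

end IdealResolution

/-- Needed so that absolute Koszulness can be tested on a homogeneous ideal. -/
theorem isGradedModule_idealGrading {I : Ideal R} (hI : I.IsHomogeneous 𝒜) :
    IsGradedModule 𝒜 (idealGrading 𝒜 I) where
  isInternal := by
    classical
    have hmem : ∀ (j : ℤ) {x : R}, x ∈ I → intProj 𝒜 j x ∈ I := by
      intro j x hx
      rcases lt_or_ge j 0 with h | h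
      · rw [intProj_of_neg 𝒜 h]; exact zero_mem _
      · obtain ⟨n, rfl⟩ := Int.eq_ofNat_of_zero_le h
        rw [intProj_natCast]
        exact hI n hx
    constructor
    · have hproj : ∀ (j : ℤ) (y : DirectSum ℤ fun j => idealGrading 𝒜 I j),
          intProj 𝒜 j (DirectSum.coeAddMonoidHom (idealGrading 𝒜 I) y : I) = ((y j : I) : R) := by
        intro j y
        induction y using DirectSum.induction_on with
        | zero => simp
        | of i y =>
          rw [DirectSum.coeAddMonoidHom_of]
          by_cases h : i = j
          · subst h
            rw [DirectSum.of_eq_same]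
            exact intProj_of_mem 𝒜 y.2
          · rw [DirectSum.of_eq_of_ne _ _ _ (Ne.symm h)]
            exact intProj_of_mem_ne 𝒜 y.2 h
        | add y z hy hz =>
          rw [map_add, Submodule.coe_add, map_add, hy, hz]
          rfl
      intro y z hyz
      refine DFinsupp.ext fun j => Subtype.ext (Subtype.ext ?_)
      rw [← hproj, hyz, hproj]
    · intro x
      obtain ⟨T, hT⟩ := (eventually_sum_intProj 𝒜 0 (x : R)).exists
      refine ⟨∑ j ∈ T, DirectSum.of (fun j => idealGrading 𝒜 I j) j
        ⟨⟨intProj 𝒜 j x, hmem j x.2⟩, intProj_mem 𝒜 j _⟩, ?_⟩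
      rw [map_sum]
      simp only [DirectSum.coeAddMonoidHom_of]
      apply Subtype.ext
      rw [Submodule.coe_sum]
      simpa only [sub_zero] using hT
  smul_mem n j a x ha hx :=
    mul_mem_intComponent 𝒜 ((mem_intComponent_natCast 𝒜).2 ha) (y := (x : R)) hx

/-- The mapping cone construction for a Betti splitting whose intersection is Koszul. -/
theorem exists_cone (hR : IsStandardGraded 𝒜) {I J : Ideal R}
    (hIJ : (I ⊓ J).IsHomogeneous 𝒜) (hs : IsBettiSplitting 𝒜 (I ⊔ J) I J)
    (hK : I ⊓ J = ⊥ ∨ IsKoszulModule 𝒜 (idealGrading 𝒜 (I ⊓ J)))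
    {A : IdealResolution 𝒜 I} (hA : A.IsMinimal) {B : IdealResolution 𝒜 J} (hB : B.IsMinimal) :
    ∃ C : IdealResolution 𝒜 (I ⊔ J), C.IsMinimal ∧
      (∀ i n, B.LinHomologyNonzero i n → C.LinHomologyNonzero i n) ∧
      ∀ a, ∃ c, C.aug (Pi.single c 1) = A.aug (Pi.single a 1) := by
  obtain ⟨P, hP, hP'⟩ := IdealResolution.exists_linear_acyclic hR hIJ hK
  obtain ⟨α, hα, hα₀, hαd⟩ := P.exists_lift inf_le_left A
  obtain ⟨β, hβ, hβ₀, hβd⟩ := P.exists_lift inf_le_right B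
  have hC := IdealResolution.isMinimal_cone A B P α β hα hβ hα₀ hβ₀ hαd hβd hR hA hB hP hs
  refine ⟨_, hC, fun i n h => IdealResolution.LinHomologyNonzero.cone A B P α β hα hβ hα₀ hβ₀
    hαd hβd hP' hC h, fun a => ⟨Sum.inl (Sum.inl a), ?_⟩⟩
  exact IdealResolution.cone_aug_single A B P α β hα hβ hα₀ hβ₀ hαd hβd a

/-- If `(0) : l = K + (l')` is a Betti splitting with Koszul intersection and `K` is not generated
by linear forms, then the first homology of the linear part of `(l)` is nonzero, and nonzero
homology for `(l')` gives nonzero homology for `(l)` in the next homological degree. -/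
theorem linHomologyNonzero_of_colon_eq (hR : IsStandardGraded 𝒜) {l l' : R} (hl : l ∈ 𝒜 1)
    (hl' : l' ∈ 𝒜 1) (hl0 : l ≠ 0) {K : Ideal R} (hK : K.IsHomogeneous 𝒜)
    (hKlin : ¬GeneratedByLinearForms 𝒜 K)
    (hsum : (⊥ : Ideal R).colon {l} = K ⊔ Ideal.span {l'})
    (hsplit : IsBettiSplitting 𝒜 ((⊥ : Ideal R).colon {l}) K (Ideal.span {l'}))
    (hKoszul : K ⊓ Ideal.span {l'} = ⊥ ∨
      IsKoszulModule 𝒜 (idealGrading 𝒜 (K ⊓ Ideal.span {l'}))) :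
    (∃ F : IdealResolution 𝒜 (Ideal.span {l}), F.IsMinimal ∧ ∃ i, F.LinHomologyNonzero i 0) ∧
      ∀ n, (∃ F : IdealResolution 𝒜 (Ideal.span {l'}), F.IsMinimal ∧
          ∃ i, F.LinHomologyNonzero i n) →
        ∃ F : IdealResolution 𝒜 (Ideal.span {l}), F.IsMinimal ∧
          ∃ i, F.LinHomologyNonzero i (n + 1) := by
  have hspan : (Ideal.span {l'}).IsHomogeneous 𝒜 :=
    Ideal.homogeneous_span 𝒜 _ (by rintro x rfl; exact ⟨1, hl'⟩)
  have hne : (⊥ : Ideal R).colon {l} ≠ ⊤ := by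
    rw [Ideal.ne_top_iff_one, Submodule.mem_colon_singleton, one_smul]
    exact hl0
  have hle : (⊥ : Ideal R).colon {l} ≤ gradedMaximalIdeal 𝒜 := by
    refine hR.le_gradedMaximalIdeal ?_ hne
    rw [hsum]
    exact hK.sup hspan
  obtain ⟨A, hA⟩ := IdealResolution.exists_isMinimal hR hK
  have hcone : ∀ B : IdealResolution 𝒜 (Ideal.span {l'}), B.IsMinimal →
      ∃ C : IdealResolution 𝒜 ((⊥ : Ideal R).colon {l}), C.IsMinimal ∧
        (∀ i n, B.LinHomologyNonzero i n → C.LinHomologyNonzero i n) ∧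
        ∀ a, ∃ c, C.aug (Pi.single c 1) = A.aug (Pi.single a 1) := by
    intro B hB
    have := exists_cone hR (hK.inf hspan) (hsum ▸ hsplit) hKoszul hA hB
    rwa [← hsum] at this
  constructor
  · obtain ⟨B, hB⟩ := IdealResolution.exists_isMinimal hR hspan
    obtain ⟨C, hC, -, hCA⟩ := hcone B hB
    obtain ⟨a, ha⟩ := A.exists_aug_mem_sq hR hKlin
      (fun h => hne (by rw [hsum, h, top_sup_eq]))
    obtain ⟨c, hc⟩ := hCA a
    exact ⟨_, hC.principal hl hle, 1, IdealResolution.linHomologyNonzero_principal_zero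
      hR.gradedMaximalIdeal_ne_top hC hl (hc ▸ ha)⟩
  · rintro n ⟨B, hB, i, hi⟩
    obtain ⟨C, hC, hCB, -⟩ := hcone B hB
    exact ⟨_, hC.principal hl hle, i + 1, (hCB i n hi).principal hl⟩

theorem linearityDefect_eq_top_of_forall {I : Ideal R}
    (h : ∀ n, ∃ F : IdealResolution 𝒜 I, F.IsMinimal ∧ ∃ i, F.LinHomologyNonzero i n) :
    linearityDefect 𝒜 (idealGrading 𝒜 I) = ⊤ := by
  rw [ENat.eq_top_iff_forall_ge]
  intro n
  obtain ⟨F, hF, i, hi⟩ := h n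
  exact le_trans (by exact_mod_cast Nat.le_succ n) (hi.le_linearityDefect hF)

end Conversion

end

theorem corollary3p3 {k : Type v} {R : Type u} [Field k] [CommRing R] [Algebra k R]
    (𝒜 : ℕ → Submodule k R) [GradedAlgebra 𝒜] (hR : IsStandardGraded 𝒜)
    (l₁ l₂ : R) (hl₁ : l₁ ∈ 𝒜 1) (hl₂ : l₂ ∈ 𝒜 1) (hl₁0 : l₁ ≠ 0) (hl₂0 : l₂ ≠ 0)
    (hl : l₁ * l₂ = 0)
    (K₁ K₂ : Ideal R) (hK₁ : K₁.IsHomogeneous 𝒜) (hK₂ : K₂.IsHomogeneous 𝒜)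
    (hK₁0 : K₁ ≠ ⊥) (hK₂0 : K₂ ≠ ⊥)
    (hK₁lin : ¬ GeneratedByLinearForms 𝒜 K₁) (hK₂lin : ¬ GeneratedByLinearForms 𝒜 K₂)
    (hsum₁ : (⊥ : Ideal R).colon {l₁} = K₂ ⊔ Ideal.span {l₂})
    (hsum₂ : (⊥ : Ideal R).colon {l₂} = K₁ ⊔ Ideal.span {l₁})
    (hsplit₁ : IsBettiSplitting 𝒜 ((⊥ : Ideal R).colon {l₁}) K₂ (Ideal.span {l₂}))
    (hsplit₂ : IsBettiSplitting 𝒜 ((⊥ : Ideal R).colon {l₂}) K₁ (Ideal.span {l₁}))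
    (hKoszul₁ : K₁ ⊓ Ideal.span {l₁} = ⊥ ∨
      IsKoszulModule 𝒜 (idealGrading 𝒜 (K₁ ⊓ Ideal.span {l₁})))
    (hKoszul₂ : K₂ ⊓ Ideal.span {l₂} = ⊥ ∨
      IsKoszulModule 𝒜 (idealGrading 𝒜 (K₂ ⊓ Ideal.span {l₂}))) :
    linearityDefect 𝒜 (idealGrading 𝒜 (Ideal.span {l₁})) = ⊤ ∧
      linearityDefect 𝒜 (idealGrading 𝒜 (Ideal.span {l₂})) = ⊤ ∧
      ¬ IsAbsolutelyKoszul 𝒜 := by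
  obtain ⟨h₁, h₁₂⟩ :=
    linHomologyNonzero_of_colon_eq hR hl₁ hl₂ hl₁0 hK₂ hK₂lin hsum₁ hsplit₁ hKoszul₂
  obtain ⟨h₂, h₂₁⟩ :=
    linHomologyNonzero_of_colon_eq hR hl₂ hl₁ hl₂0 hK₁ hK₁lin hsum₂ hsplit₂ hKoszul₁
  -- Both ideals go through the induction together, because each step for one uses the previous
  -- degree of the other. The resolution may change with n.
  have hall : ∀ n,
      (∃ F : IdealResolution 𝒜 (Ideal.span {l₁}), F.IsMinimal ∧ ∃ i, F.LinHomologyNonzero i n) ∧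
      (∃ F : IdealResolution 𝒜 (Ideal.span {l₂}), F.IsMinimal ∧ ∃ i, F.LinHomologyNonzero i n) := by
    intro n
    induction n with
    | zero => exact ⟨h₁, h₂⟩
    | succ n ih => exact ⟨h₁₂ n ih.2, h₂₁ n ih.1⟩
  have htop := linearityDefect_eq_top_of_forall fun n => (hall n).1
  refine ⟨htop, linearityDefect_eq_top_of_forall fun n => (hall n).2, fun habs => ?_⟩
  have := hR.isNoetherianRing
  have hspan : (Ideal.span {l₁}).IsHomogeneous 𝒜 :=
    Ideal.homogeneous_span 𝒜 _ (by rintro x rfl; exact ⟨1, hl₁⟩)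
  exact (habs (Ideal.span {l₁}) _ (isGradedModule_idealGrading hspan)).ne htop
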